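/- For a finite simple graph $G=(V,E)$ and $A\subseteq V$, the size of the cut $(A,V\setminus A)$ is the number of edges of $G$ with one endpoint in $A$ and the other in $V\setminus A$; let $mc(G)$ be the maximum size of a cut of $G$. A graph is subcubic if all its vertices have degree at most $3$. There is an $O(n)$-time deterministic combinatorial $\frac56$-approximation algorithm for Max-Cut in subcubic graphs. That is, there are a single program of a unit-cost random access machine and a constant $C$ such that, for every $n$ and every subcubic graph $G$ (connected or not) on the vertices $0,\dots,n-1$, given by $n$ and adjacency lists in arbitrary order (stored one after another in an array, with the position of each list), the program halts after at most $C\,(n+1)$ steps and outputs a set $A\subseteq V(G)$ for which the cut $(A,V(G)\setminus A)$ has size at least $\frac56\,mc(G)$. Here the machine has finitely many registers and arrays of natural numbers (zero outside the input); its operations, each of which costs one step, are constants, reading and writing registers and array cells (at computed positions), successor, truncated subtraction, comparisons and Boolean combinations of them; its control structures are sequencing, branching and while loops. In particular no numerical subroutines are available, and the numbers that occur within $O(n)$ steps on such an input are $O(n)$, so they fit into words of $O(\log n)$ bits. -/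

import Mathlib

/-! ### Cuts of a graph -/

namespace MaxCut

/-- The set of the edges of `G` with one endpoint in `A` and the other in `B`. -/
def edgesBetween {V : Type*} (G : SimpleGraph V) (A B : Set V) : Set (Sym2 V) :=
  {e | e ∈ G.edgeSet ∧ ∃ u ∈ A, ∃ v ∈ B, e = s(u, v)}

/-- The size of the cut `(A, V \ A)` of `G`. -/
noncomputable def cutSize {V : Type*} (G : SimpleGraph V) (A : Finset V) : ℕ :=
  (edgesBetween G (A : Set V) (A : Set V)ᶜ).ncard

/-- The size of a maximum cut of the finite graph `G`. -/
noncomputable def maxCut {V : Type*} [Fintype V] (G : SimpleGraph V) : ℕ :=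
  (Finset.univ : Finset (Finset V)).sup (cutSize G)

end MaxCut

/-! ### A unit-cost random access machine

The machine has registers and arrays of natural numbers, addressed by constants in the program;
a program is a finite term, so that it uses finitely many of them.  Array cells are addressed by
computed values.  The only arithmetic is successor and truncated subtraction. In particular `t` steps
raise the largest number in use by at most `t` above the input and the constants of the program:
in linear time all words have `O(log n)` bits, and charging one unit for every operation is the
usual word-RAM cost.  There are no numerical operations (not even addition or multiplication) that
a program could take as a subroutine. -/

namespace RAM

/-- Contents of the machine: register `x` holds `reg x`, cell `i` of array `a` holds `arr a i`. -/
@[ext]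
structure State where
  reg : ℕ → ℕ
  arr : ℕ → ℕ → ℕ

/-- Expressions: constants, registers, array cells, successor and truncated subtraction. -/
inductive Exp where
  | const (k : ℕ)
  | reg (x : ℕ)
  | read (a : ℕ) (i : Exp)
  | succ (e : Exp)
  | sub (e₁ e₂ : Exp)

/-- The value of an expression. -/
def Exp.eval (s : State) : Exp → ℕ
  | .const k => k
  | .reg x => s.reg x
  | .read a i => s.arr a (i.eval s)
  | .succ e => e.eval s + 1
  | .sub e₁ e₂ => e₁.eval s - e₂.eval s

/-- The cost of evaluating an expression: one unit for every operation in it. -/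
def Exp.cost : Exp → ℕ
  | .const _ => 1
  | .reg _ => 1
  | .read _ i => i.cost + 1
  | .succ e => e.cost + 1
  | .sub e₁ e₂ => e₁.cost + e₂.cost + 1

/-- Tests: comparisons of expressions, and their Boolean combinations. -/
inductive Test where
  | lt (e₁ e₂ : Exp)
  | eq (e₁ e₂ : Exp)
  | not (b : Test)
  | and (b₁ b₂ : Test)

/-- The truth of a test. -/
def Test.Holds (s : State) : Test → Prop
  | .lt e₁ e₂ => e₁.eval s < e₂.eval s
  | .eq e₁ e₂ => e₁.eval s = e₂.eval s
  | .not b => ¬ b.Holds s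
  | .and b₁ b₂ => b₁.Holds s ∧ b₂.Holds s

/-- The cost of evaluating a test: one unit for every operation in it. -/
def Test.cost : Test → ℕ
  | .lt e₁ e₂ => e₁.cost + e₂.cost + 1
  | .eq e₁ e₂ => e₁.cost + e₂.cost + 1
  | .not b => b.cost + 1
  | .and b₁ b₂ => b₁.cost + b₂.cost + 1

/-- Programs. -/
inductive Prog where
  | skip
  | assign (x : ℕ) (e : Exp)
  | write (a : ℕ) (i e : Exp)
  | seq (p q : Prog)
  | ite (b : Test) (p q : Prog)
  | loop (b : Test) (p : Prog)

/-- Store `k` in register `x`. -/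
def State.setReg (s : State) (x k : ℕ) : State where
  reg := Function.update s.reg x k
  arr := s.arr

/-- Store `k` in cell `i` of array `a`. -/
def State.setArr (s : State) (a i k : ℕ) : State where
  reg := s.reg
  arr := Function.update s.arr a (Function.update (s.arr a) i k)

/-- `Exec p s s' t`: started in the state `s`, the program `p` halts in the state `s'` after exactly
`t` steps.  Programs are deterministic: `s'` and `t` are determined by `p` and `s`. -/
inductive Exec : Prog → State → State → ℕ → Prop where
  | skip (s : State) : Exec .skip s s 1
  | assign (s : State) (x : ℕ) (e : Exp) :
      Exec (.assign x e) s (s.setReg x (e.eval s)) (e.cost + 1)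
  | write (s : State) (a : ℕ) (i e : Exp) :
      Exec (.write a i e) s (s.setArr a (i.eval s) (e.eval s)) (i.cost + e.cost + 1)
  | seq {p q : Prog} {s s' s'' : State} {t t' : ℕ} :
      Exec p s s' t → Exec q s' s'' t' → Exec (.seq p q) s s'' (t + t')
  | ite_true {b : Test} {p q : Prog} {s s' : State} {t : ℕ} :
      b.Holds s → Exec p s s' t → Exec (.ite b p q) s s' (b.cost + 1 + t)
  | ite_false {b : Test} {p q : Prog} {s s' : State} {t : ℕ} :
      ¬ b.Holds s → Exec q s s' t → Exec (.ite b p q) s s' (b.cost + 1 + t)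
  | loop_true {b : Test} {p : Prog} {s s' s'' : State} {t t' : ℕ} :
      b.Holds s → Exec p s s' t → Exec (.loop b p) s' s'' t' →
        Exec (.loop b p) s s'' (b.cost + 1 + t + t')
  | loop_false {b : Test} {p : Prog} {s : State} :
      ¬ b.Holds s → Exec (.loop b p) s s (b.cost + 1)

end RAM

/-! ### Graphs as inputs, cuts as outputs -/

namespace MaxCut

/-- `adj` is an adjacency-list representation of the graph `G` on the vertices `0, …, n - 1`: for
every vertex, `adj` lists its neighbours, each of them once, in an arbitrary order. -/
def IsAdjacencyList {n : ℕ} (G : SimpleGraph (Fin n)) (adj : Fin n → List (Fin n)) : Prop :=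
  ∀ v, (adj v).Nodup ∧ ∀ u, u ∈ adj v ↔ G.Adj v u

/-- The initial state of the machine on the input `adj`.  Register `0` holds the number `n` of
vertices.  Array `1` holds the concatenation of the lists `adj 0, …, adj (n - 1)`.  For `i ≤ n`, cell
`i` of array `0` holds the total length of the lists of the vertices below `i`, so that the list of
`v` occupies the cells `k` of array `1` with `arr 0 v ≤ k < arr 0 (v + 1)`.
All other registers and cells hold `0`. -/
def inputState {n : ℕ} (adj : Fin n → List (Fin n)) : RAM.State where
  reg x := if x = 0 then n else 0
  arr a i :=
    if a = 0 then
      if i ≤ n then ∑ u : Fin n with u.val < i, (adj u).length else 0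
    else if a = 1 then
      ((List.ofFn adj).flatten.map Fin.val).getD i 0
    else 0

/-- The output, read off from array `2`: the vertex set `A` of the cut `(A, V \ A)` consists of the
vertices `v` for which cell `v` of array `2` is not `0`. -/
def outputSet (n : ℕ) (s : RAM.State) : Finset (Fin n) :=
  {v : Fin n | s.arr 2 v.val ≠ 0}

end MaxCut

namespace MaxCut

/-! Local search attains the ratio. Let `A` be a cut that no flip of a connected set of at most 520
vertices improves, `B` a maximum cut, `R` the graph of the edges cut by both, and let `a v` and `b
v` count the edges at `v` cut only by `B` and only by `A`. What has to be shown is that the sum of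
`ideg R v + 6 * b v - 5 * a v` is nonnegative (`LocallyBalanced.sum_nonneg`). Membership in the
symmetric difference of `A` and `B` is constant on a set `T` connected in `R`, so no edge inside `T`
is cut by just one of them, and flipping `T` improves `A` by at least `gain R a b T`.

The sum is handled by discharging. Single flips show that a negative term occurs only at a weak
vertex (`a v = 1`, `b v = 0`), where it is `ideg R v - 5` with `ideg R v` equal to 1 or 2. The other
vertices pay for this along edges of `R`. If a connected set `S` without weak vertices is flipped
together with the weak vertices around it, every edge from `S` to a weak vertex `w` adds at least
`toll R a b w` to the gain. Since the gain is not positive, the surplus of `S` covers twice its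
tolls if `S` has at least four vertices or some `b v ≠ 0` (`toll_le_of_card_le`); sets of more than
40 vertices are cut into pieces by `Linked.exists_split`. The exceptional small components can pay
only 1 per edge, and `toll_eq_one` and `eq_of_tight` show that this suffices. As a set and its halo
have at most 13 times the size of the set, the bound is `13 * 40 = 520`.

For the running time, a stack holds every vertex around which an improving flip may exist. Degrees
are bounded, so a constant number of flips lies near a vertex, and an improvement affects only
boundedly many vertices, which are pushed again. There are at most `3 * n` improvements, so the
number of pops is linear. -/

open scoped Classical in
/-- The `0`-`1` adjacency indicator of a graph. -/
noncomputable def ind {V : Type*} (R : SimpleGraph V) (u v : V) : ℤ := if R.Adj u v then 1 else 0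

theorem ind_comm {V : Type*} (R : SimpleGraph V) (u v : V) : ind R u v = ind R v u := by
  by_cases h : R.Adj u v
  · simp [ind, h, h.symm]
  · simp [ind, h, mt R.adj_symm h]

theorem ind_nonneg {V : Type*} (R : SimpleGraph V) (u v : V) : 0 ≤ ind R u v := by
  unfold ind; split_ifs <;> simp

theorem ind_of_adj {V : Type*} {R : SimpleGraph V} {u v : V} (h : R.Adj u v) : ind R u v = 1 := by
  simp [ind, h]

theorem ind_of_not_adj {V : Type*} {R : SimpleGraph V} {u v : V} (h : ¬ R.Adj u v) :
    ind R u v = 0 := by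
  simp [ind, h]

/-! ### Connected vertex sets: growing, joining and splitting them -/

/-- `S` induces a connected subgraph: it is nonempty, and an edge leaves every proper part of it. -/
def Linked {V : Type*} (R : SimpleGraph V) (S : Finset V) : Prop :=
  S.Nonempty ∧ ∀ T ⊆ S, T.Nonempty → T ≠ S → ∃ u ∈ T, ∃ v ∈ S, v ∉ T ∧ R.Adj u v

theorem linked_singleton {V : Type*} {R : SimpleGraph V} (v : V) : Linked R {v} := by
  refine ⟨by simp, fun T hT hne hT' => ?_⟩
  rcases Finset.subset_singleton_iff.1 hT with h | h
  · simp [h] at hne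
  · exact absurd h hT'

section Linked

variable {V : Type*} [DecidableEq V] {R : SimpleGraph V}

theorem Linked.exists_adj_compl {S : Finset V} (hS : Linked R S) {T : Finset V} {x y : V}
    (hx : x ∈ S) (hxT : x ∈ T) (hy : y ∈ S) (hyT : y ∉ T) :
    ∃ u ∈ S, ∃ v ∈ S, u ∈ T ∧ v ∉ T ∧ R.Adj u v := by
  obtain ⟨u, hu, v, hv, hvT, h⟩ := hS.2 (S ∩ T) Finset.inter_subset_left
    ⟨x, by simp [hx, hxT]⟩ (fun h => hyT (by
      have : y ∈ S ∩ T := by rw [h]; exact hy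
      exact (Finset.mem_inter.1 this).2))
  rw [Finset.mem_inter] at hu
  exact ⟨u, hu.1, v, hv, hu.2, fun h' => hvT (by simp [hv, h']), h⟩

theorem linked_of_exists {S : Finset V} (hne : S.Nonempty)
    (h : ∀ T : Finset V, ∀ x ∈ S, ∀ y ∈ S, x ∈ T → y ∉ T →
      ∃ u ∈ S, ∃ v ∈ S, u ∈ T ∧ v ∉ T ∧ R.Adj u v) : Linked R S := by
  refine ⟨hne, fun T hT ⟨x, hx⟩ hT' => ?_⟩
  obtain ⟨y, hy, hyT⟩ : ∃ y ∈ S, y ∉ T := by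
    by_contra! hcon
    exact hT' (hT.antisymm hcon)
  obtain ⟨u, -, v, hv, huT, hvT, huv⟩ := h T x (hT hx) y hy hx hyT
  exact ⟨u, huT, v, hv, hvT, huv⟩

theorem Linked.union_of_adj {S S' : Finset V} (hS : Linked R S) (hS' : Linked R S') {u v : V}
    (hu : u ∈ S) (hv : v ∈ S') (h : R.Adj u v) : Linked R (S ∪ S') := by
  refine linked_of_exists (hS.1.mono Finset.subset_union_left) fun T x hx y hy hxT hyT => ?_
  by_cases h1 : (∃ x ∈ S, x ∈ T) ∧ ∃ y ∈ S, y ∉ T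
  · obtain ⟨⟨x, hx, hxT⟩, y, hy, hyT⟩ := h1
    obtain ⟨u, hu, v, hv, h⟩ := hS.exists_adj_compl hx hxT hy hyT
    exact ⟨u, by simp [hu], v, by simp [hv], h⟩
  by_cases h2 : (∃ x ∈ S', x ∈ T) ∧ ∃ y ∈ S', y ∉ T
  · obtain ⟨⟨x, hx, hxT⟩, y, hy, hyT⟩ := h2
    obtain ⟨u, hu, v, hv, h⟩ := hS'.exists_adj_compl hx hxT hy hyT
    exact ⟨u, by simp [hu], v, by simp [hv], h⟩
  by_cases huT : u ∈ T <;> by_cases hvT : v ∈ T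
  · grind
  · exact ⟨u, by simp [hu], v, by simp [hv], huT, hvT, h⟩
  · exact ⟨v, by simp [hv], u, by simp [hu], hvT, huT, h.symm⟩
  · grind

theorem Linked.attach {S S' : Finset V} (hS : Linked R S) (hSS' : S ⊆ S')
    (h : ∀ x ∈ S', x ∈ S ∨ ∃ y ∈ S, R.Adj x y) : Linked R S' := by
  refine linked_of_exists (hS.1.mono hSS') fun T x hx y hy hxT hyT => ?_
  by_cases h1 : (∃ x ∈ S, x ∈ T) ∧ ∃ y ∈ S, y ∉ T
  · obtain ⟨⟨x, hx, hxT⟩, y, hy, hyT⟩ := h1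
    obtain ⟨u, hu, v, hv, h⟩ := hS.exists_adj_compl hx hxT hy hyT
    exact ⟨u, hSS' hu, v, hSS' hv, h⟩
  rcases h x hx with hxS | ⟨x', hx', hxx'⟩
  · rcases h y hy with hyS | ⟨y', hy', hyy'⟩
    · exact absurd ⟨⟨x, hxS, hxT⟩, y, hyS, hyT⟩ h1
    · have : y' ∈ T := by grind
      exact ⟨y', hSS' hy', y, hy, this, hyT, hyy'.symm⟩
  · by_cases hx'T : x' ∈ T
    · rcases h y hy with hyS | ⟨y', hy', hyy'⟩
      · exact absurd ⟨⟨x', hx', hx'T⟩, y, hyS, hyT⟩ h1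
      · have : y' ∈ T := by grind
        exact ⟨y', hSS' hy', y, hy, this, hyT, hyy'.symm⟩
    · exact ⟨x, hx, x', hSS' hx', hxT, hx'T, hxx'⟩

theorem Linked.insert_of_adj {S : Finset V} (hS : Linked R S) {u v : V} (hu : u ∈ S) (h : R.Adj u v) :
    Linked R (insert v S) :=
  hS.attach (Finset.subset_insert _ _) fun x hx => by
    rcases Finset.mem_insert.1 hx with rfl | hx
    · exact Or.inr ⟨u, hu, h.symm⟩
    · exact Or.inl hx

/-- Grow the set one vertex at a time along a leaving edge. Each new vertex brings an edge, which
the sum over ordered pairs counts twice. -/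
theorem Linked.exists_subset_card {S : Finset V} (hS : Linked R S) (j : ℕ) (hj : j + 1 ≤ S.card) :
    ∃ T ⊆ S, T.card = j + 1 ∧ Linked R T ∧
      2 * (j : ℤ) ≤ ∑ u ∈ T, ∑ v ∈ T, ind R u v := by
  induction j with
  | zero =>
    obtain ⟨v, hv⟩ := hS.1
    exact ⟨{v}, by simpa using hv, by simp, linked_singleton v, by simp [ind_nonneg]⟩
  | succ j ih =>
    obtain ⟨T, hT, hc, hl, he⟩ := ih (by omega)
    obtain ⟨u, hu, v, hv, hvT, h⟩ := hS.2 T hT hl.1 (by rintro rfl; omega)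
    refine ⟨insert v T, Finset.insert_subset hv hT, by simp [hvT, hc], hl.insert_of_adj hu h, ?_⟩
    simp only [Finset.sum_insert hvT, Finset.sum_add_distrib]
    have h1 : 1 ≤ ∑ w ∈ T, ind R v w := by
      rw [← ind_of_adj h.symm]
      exact Finset.single_le_sum (f := fun w => ind R v w) (fun _ _ => ind_nonneg _ _ _) hu
    have h2 : ∑ w ∈ T, ind R w v = ∑ w ∈ T, ind R v w :=
      Finset.sum_congr rfl fun _ _ => ind_comm _ _ _
    have := ind_nonneg R v v
    push_cast
    linarith

theorem Linked.two_mul_card_le {S : Finset V} (hS : Linked R S) :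
    2 * (S.card : ℤ) - 2 ≤ ∑ u ∈ S, ∑ v ∈ S, ind R u v := by
  have h0 := hS.1.card_pos
  obtain ⟨T, hT, hc, -, he⟩ := hS.exists_subset_card (S.card - 1) (by omega)
  obtain rfl : T = S := Finset.eq_of_subset_of_card_le hT (by omega)
  have : ((T.card - 1 : ℕ) : ℤ) = T.card - 1 := by push_cast [Nat.cast_sub h0]; rfl
  linarith

theorem exists_linked_component (R : SimpleGraph V) (U : Finset V) {x : V} (hx : x ∈ U) :
    ∃ W ⊆ U, x ∈ W ∧ Linked R W ∧ ∀ u ∈ W, ∀ v ∈ U, v ∉ W → ¬ R.Adj u v := by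
  classical
  obtain ⟨W, hW, hmax⟩ := Finset.exists_max_image
    (U.powerset.filter fun W => x ∈ W ∧ Linked R W) Finset.card
    ⟨{x}, by simp [hx, linked_singleton]⟩
  simp only [Finset.mem_filter, Finset.mem_powerset] at hW hmax
  refine ⟨W, hW.1, hW.2.1, hW.2.2, fun u hu v hv hvW h => ?_⟩
  have := hmax (insert v W) ⟨Finset.insert_subset hv hW.1, by simp [hW.2.1], hW.2.2.insert_of_adj hu h⟩
  rw [Finset.card_insert_of_notMem hvW] at this
  omega

theorem Linked.subset_of_closed {K U : Finset V} (hK : Linked R K) {x : V} (hx : x ∈ K)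
    (hxU : x ∈ U) (h : ∀ u ∈ U, ∀ v ∈ K, v ∉ U → ¬ R.Adj u v) : K ⊆ U := by
  intro y hy
  by_contra hyU
  obtain ⟨u, -, v, hv, huU, hvU, huv⟩ := hK.exists_adj_compl hx hxU hy hyU
  exact h u huU v hv hvU huv

/-- Remove a connected set `C` of four vertices. Every component of the rest contains one of the at
most 12 neighbours of `C`; if all had at most three vertices, `U` would have at most `4 + 36 = 40`.
A component with four or more can be split off, as the others remain attached to `C`. -/
theorem Linked.exists_split {U : Finset V} (hU : Linked R U)
    (hdeg : ∀ u, ∃ N : Finset V, N.card ≤ 3 ∧ ∀ v, R.Adj u v → v ∈ N) (hc : 40 < U.card) :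
    ∃ W ⊆ U, Linked R W ∧ 4 ≤ W.card ∧ Linked R (U \ W) ∧ 4 ≤ (U \ W).card := by
  choose N hN hN' using hdeg
  obtain ⟨C, hC, hCc, hCl, -⟩ := hU.exists_subset_card 3 (by omega)
  have hcomp : ∀ x, ∃ W : Finset V, x ∈ U \ C → W ⊆ U \ C ∧ x ∈ W ∧ Linked R W ∧
      ∀ u ∈ W, ∀ v ∈ U \ C, v ∉ W → ¬ R.Adj u v := fun x => by
    by_cases hx : x ∈ U \ C
    · obtain ⟨W, h⟩ := exists_linked_component R (U \ C) hx
      exact ⟨W, fun _ => h⟩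
    · exact ⟨∅, fun h => absurd h hx⟩
  choose W hW using hcomp
  obtain ⟨x, hx, hWx⟩ : ∃ x ∈ U \ C, 4 ≤ (W x).card := by
    by_contra! hsmall
    -- Since `U` is connected, an edge leaves the component of `y`, and it can only end in `C`.
    have hsub : U \ C ⊆ (C.biUnion N ∩ (U \ C)).biUnion W := fun y hy => by
      obtain ⟨hWU, hyW, hWl, hWc⟩ := hW y hy
      obtain ⟨c, hcC⟩ := hCl.1
      obtain ⟨u, hu, v, hv, huW, hvW, huv⟩ := hU.exists_adj_compl
        (Finset.mem_sdiff.1 hy).1 hyW (hC hcC) (fun h => (Finset.mem_sdiff.1 (hWU h)).2 hcC)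
      have hvC : v ∈ C := by
        by_contra hvC
        exact hWc u huW v (by simp [hv, hvC]) hvW huv
      have huU := hWU huW
      obtain ⟨hWU', huW', hWl', hWc'⟩ := hW u huU
      have hsub' : W y ⊆ W u := hWl.subset_of_closed huW huW' fun p hp q hq hq' =>
        hWc' p hp q (hWU hq) hq'
      exact Finset.mem_biUnion.2 ⟨u, by
        simp only [Finset.mem_inter, Finset.mem_biUnion]
        exact ⟨⟨v, hvC, hN' v u huv.symm⟩, huU⟩, hsub' hyW⟩
    have h1 := Finset.card_le_card hsub
    have h2 : ((C.biUnion N ∩ (U \ C)).biUnion W).card ≤ (C.biUnion N ∩ (U \ C)).card * 3 :=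
      Finset.card_biUnion_le_card_mul _ _ _ fun z hz => by
        have := hsmall z (Finset.mem_inter.1 hz).2
        omega
    have h3 : (C.biUnion N ∩ (U \ C)).card ≤ (C.biUnion N).card :=
      Finset.card_le_card Finset.inter_subset_left
    have h4 : (C.biUnion N).card ≤ C.card * 3 := Finset.card_biUnion_le_card_mul _ _ _ fun z _ => hN z
    have h5 := Finset.card_sdiff_add_card_eq_card hC
    omega
  obtain ⟨hWU, hxW, hWl, hWc⟩ := hW x hx
  have hCW : C ⊆ U \ W x := fun c hc => by
    simp only [Finset.mem_sdiff]
    exact ⟨hC hc, fun h => (Finset.mem_sdiff.1 (hWU h)).2 hc⟩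
  refine ⟨W x, hWU.trans Finset.sdiff_subset, hWl, hWx, ?_, ?_⟩
  · refine linked_of_exists (hCl.1.mono hCW) fun T p hp q hq hpT hqT => ?_
    by_cases h1 : (∃ x ∈ C, x ∈ T) ∧ ∃ y ∈ C, y ∉ T
    · obtain ⟨⟨x, hx, hxT⟩, y, hy, hyT⟩ := h1
      obtain ⟨u, hu, v, hv, h⟩ := hCl.exists_adj_compl hx hxT hy hyT
      exact ⟨u, hCW hu, v, hCW hv, h⟩
    rw [Finset.mem_sdiff] at hp hq
    -- Now `C` lies on one side of `T`. Putting `W x` on the same side as `C` forces the crossing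
    -- edge of `U` to avoid `W x`.
    by_cases h2 : ∃ x ∈ C, x ∈ T
    · have hCT : C ⊆ T := fun y hy => by
        by_contra hyT
        exact h1 ⟨h2, y, hy, hyT⟩
      obtain ⟨u, hu, v, hv, huT, hvT, huv⟩ := hU.exists_adj_compl (T := T ∪ W x) (x := p) (y := q)
        hp.1 (by simp [hpT]) hq.1 (by simp [hqT, hq.2])
      simp only [Finset.mem_union, not_or] at huT hvT
      have huW : u ∉ W x := fun h =>
        hWc u h v (by simp only [Finset.mem_sdiff]; exact ⟨hv, fun h => hvT.1 (hCT h)⟩) hvT.2 huv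
      refine ⟨u, by simp [hu, huW], v, by simp [hv, hvT.2], by simpa [huW] using huT, hvT.1, huv⟩
    · obtain ⟨u, hu, v, hv, huT, hvT, huv⟩ := hU.exists_adj_compl (T := T \ W x) (x := p) (y := q)
        hp.1 (by simp [hpT, hp.2]) hq.1 (by simp [hqT])
      simp only [Finset.mem_sdiff, not_and, not_not] at huT hvT
      have hvW : v ∉ W x := fun h => hWc v h u (by
        simp only [Finset.mem_sdiff]; exact ⟨hu, fun h => h2 ⟨u, h, huT.1⟩⟩) huT.2 huv.symm
      exact ⟨u, by simp [hu, huT.2], v, by simp [hv, hvW], huT.1, fun h => hvW (hvT h), huv⟩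
  · have := Finset.card_le_card hCW
    omega

end Linked

/-! ### Local optimality as inequalities at the vertices -/

section Discharging

variable {V : Type*} [Fintype V]

/-- The degree of a vertex, as an integer. -/
noncomputable def ideg (R : SimpleGraph V) (v : V) : ℤ := ∑ w, ind R v w

/-- The vertices whose flip loses as much as possible: they meet one edge of the first kind
and none of the second. -/
def weak [DecidableEq V] (a b : V → ℤ) : Finset V := Finset.univ.filter fun v => a v = 1 ∧ b v = 0

/-- The gain of flipping `T`, if `v` meets `a v` edges that become cut, `b v` that become uncut, and
the edges of `R` stay cut inside `T`. -/
noncomputable def gain (R : SimpleGraph V) (a b : V → ℤ) (T : Finset V) : ℤ :=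
  ∑ v ∈ T, (a v - b v - ideg R v + ∑ w ∈ T, ind R v w)

/-- No small connected set has a positive gain, and the total degrees are at most three. -/
structure LocallyBalanced (R : SimpleGraph V) (a b : V → ℤ) : Prop where
  left_nonneg : ∀ v, 0 ≤ a v
  right_nonneg : ∀ v, 0 ≤ b v
  degree_le : ∀ v, a v + b v + ideg R v ≤ 3
  gain_nonpos : ∀ T, Linked R T → T.card ≤ 520 → gain R a b T ≤ 0

open scoped Classical in
theorem ideg_eq_card (R : SimpleGraph V) (v : V) :
    ideg R v = (Finset.univ.filter fun w => R.Adj v w).card := by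
  simp [ideg, ind]

theorem sum_ind_le_ideg (R : SimpleGraph V) (v : V) (S : Finset V) :
    ∑ w ∈ S, ind R v w ≤ ideg R v :=
  Finset.sum_le_sum_of_subset_of_nonneg (Finset.subset_univ _) fun _ _ _ => ind_nonneg _ _ _

theorem exists_adj_of_ideg_eq_one {R : SimpleGraph V} {v : V} (h : ideg R v = 1) :
    ∃ u, R.Adj v u := by
  classical
  rw [ideg_eq_card] at h
  obtain ⟨u, hu⟩ := Finset.card_pos.1
    (show 0 < (Finset.univ.filter fun w => R.Adj v w).card by omega)
  exact ⟨u, by simpa using hu⟩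

theorem exists_adj_of_ideg_eq_two {R : SimpleGraph V} {v : V} (h : ideg R v = 2) :
    ∃ u₁ u₂, u₁ ≠ u₂ ∧ R.Adj v u₁ ∧ R.Adj v u₂ ∧ ∀ u, R.Adj v u → u = u₁ ∨ u = u₂ := by
  classical
  rw [ideg_eq_card] at h
  obtain ⟨u₁, u₂, hne, hu⟩ := Finset.card_eq_two.1
    (show (Finset.univ.filter fun w => R.Adj v w).card = 2 by exact_mod_cast h)
  have hmem : ∀ u, R.Adj v u ↔ u = u₁ ∨ u = u₂ := fun u => by
    have := congrArg (u ∈ ·) hu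
    simpa using this
  exact ⟨u₁, u₂, hne, by simp [hmem], by simp [hmem], fun u => (hmem u).1⟩

namespace LocallyBalanced

variable {R : SimpleGraph V} {a b : V → ℤ}

theorem ideg_le (h : LocallyBalanced R a b) (v : V) : ideg R v ≤ 3 := by
  have := h.degree_le v
  have := h.left_nonneg v
  have := h.right_nonneg v
  linarith

theorem left_le (h : LocallyBalanced R a b) (v : V) : a v ≤ b v + ideg R v := by
  have := h.gain_nonpos {v} (linked_singleton v) (by simp)
  simp only [gain, Finset.sum_singleton] at this
  have := ind_nonneg R v v
  linarith

/-- Adding `a v` to both sides of `a v ≤ b v + ideg R v` bounds `2 * a v` by the degree, hence by 3.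
-/
theorem left_le_one (h : LocallyBalanced R a b) (v : V) : a v ≤ 1 := by
  have := h.left_le v
  have := h.degree_le v
  omega

end LocallyBalanced

variable [DecidableEq V] {R : SimpleGraph V} {a b : V → ℤ}

theorem mem_weak {v : V} : v ∈ weak a b ↔ a v = 1 ∧ b v = 0 := by simp [weak]

/-! ### Tolls: flipping a set together with the weak vertices around it -/

open scoped Classical in
/-- What an edge between a weak vertex and a vertex that is not weak contributes to a gain. -/
noncomputable def toll (R : SimpleGraph V) (a b : V → ℤ) (w : V) : ℤ :=
  if ideg R w = 2 ∧ ∀ u ∈ weak a b, ¬ R.Adj w u then 1 else 2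

open scoped Classical in
/-- The weak vertices next to `S`. -/
noncomputable def fringe (R : SimpleGraph V) (a b : V → ℤ) (S : Finset V) : Finset V :=
  (weak a b).filter fun w => ∃ v ∈ S, R.Adj w v

/-- The weak vertices next to `S`, and the weak vertices next to these. -/
noncomputable def halo (R : SimpleGraph V) (a b : V → ℤ) (S : Finset V) : Finset V :=
  fringe R a b S ∪ fringe R a b (fringe R a b S)

theorem toll_eq (R : SimpleGraph V) (a b : V → ℤ) (w : V) :
    toll R a b w = 1 ∨ toll R a b w = 2 := by
  unfold toll; split_ifs <;> simp

theorem halo_subset_weak (S : Finset V) : halo R a b S ⊆ weak a b := by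
  classical
  exact Finset.union_subset (Finset.filter_subset _ _) (Finset.filter_subset _ _)

theorem mem_fringe {S : Finset V} {w : V} :
    w ∈ fringe R a b S ↔ w ∈ weak a b ∧ ∃ v ∈ S, R.Adj w v := by
  simp [fringe]

theorem mem_halo_of_adj {S : Finset V} {v w : V} (hw : w ∈ weak a b) (hv : v ∈ S)
    (h : R.Adj w v) : w ∈ halo R a b S :=
  Finset.mem_union_left _ (mem_fringe.2 ⟨hw, v, hv, h⟩)

theorem Linked.union_fringe {S T : Finset V} (hT : Linked R T) (h : S ⊆ T) :
    Linked R (T ∪ fringe R a b S) :=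
  hT.attach Finset.subset_union_left fun x hx => by
    rcases Finset.mem_union.1 hx with hx | hx
    · exact Or.inl hx
    · obtain ⟨-, v, hv, hxv⟩ := mem_fringe.1 hx
      exact Or.inr ⟨v, h hv, hxv⟩

theorem Linked.union_halo {S T : Finset V} (hT : Linked R T) (h : S ⊆ T) :
    Linked R (T ∪ halo R a b S) := by
  rw [halo, ← Finset.union_assoc]
  exact (hT.union_fringe h).union_fringe Finset.subset_union_right

namespace LocallyBalanced

theorem card_fringe_le (h : LocallyBalanced R a b) (S : Finset V) :
    (fringe R a b S).card ≤ 3 * S.card := by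
  classical
  have hsub : fringe R a b S ⊆ S.biUnion fun v => Finset.univ.filter fun w => R.Adj v w :=
    fun w hw => by
      obtain ⟨-, v, hv, hwv⟩ := mem_fringe.1 hw
      simp only [Finset.mem_biUnion, Finset.mem_filter, Finset.mem_univ, true_and]
      exact ⟨v, hv, hwv.symm⟩
  refine (Finset.card_le_card hsub).trans ?_
  rw [mul_comm]
  refine Finset.card_biUnion_le_card_mul _ _ _ fun v _ => ?_
  have := h.ideg_le v
  rw [ideg_eq_card] at this
  exact_mod_cast this

/-- The two layers have at most 3 and 9 times as many vertices as `S`. -/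
theorem card_union_halo_le (h : LocallyBalanced R a b) (S : Finset V) :
    (S ∪ halo R a b S).card ≤ 13 * S.card := by
  have h1 := h.card_fringe_le S
  have h2 := h.card_fringe_le (fringe R a b S)
  have h3 := Finset.card_union_le S (halo R a b S)
  have h4 := Finset.card_union_le (fringe R a b S) (fringe R a b (fringe R a b S))
  rw [halo] at *
  omega

theorem left_le_right (h : LocallyBalanced R a b) {v : V} (hv : v ∉ weak a b) : a v ≤ b v := by
  have h1 := h.left_le_one v
  have h2 := h.left_nonneg v
  have h3 := h.right_nonneg v
  rw [mem_weak] at hv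
  omega

theorem ideg_of_mem_weak (h : LocallyBalanced R a b) {v : V} (hv : v ∈ weak a b) :
    ideg R v = 1 ∨ ideg R v = 2 := by
  have h1 := h.left_le v
  have h2 := h.degree_le v
  rw [mem_weak] at hv
  omega

/-- A weak vertex with a weak neighbour has a second neighbour. -/
theorem ideg_eq_two_of_adj_weak (h : LocallyBalanced R a b) {u w : V} (hu : u ∈ weak a b)
    (hw : w ∈ weak a b) (huw : R.Adj w u) : ideg R w = 2 := by
  rcases h.ideg_of_mem_weak hw with h1 | h1
  -- If `u` were the only neighbour of `w`, flipping both would gain at least 1 from `w` and 0 from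
  -- `u`.
  · have h2 := h.gain_nonpos {w, u}
      (by simpa [Finset.pair_comm] using (linked_singleton w).insert_of_adj (by simp) huw)
      ((Finset.card_le_two).trans (by norm_num))
    rw [gain, Finset.sum_pair huw.ne, Finset.sum_pair huw.ne, Finset.sum_pair huw.ne,
      ind_of_adj huw, ind_of_adj huw.symm] at h2
    have h3 := h.ideg_of_mem_weak hu
    have := ind_nonneg R w w
    have := ind_nonneg R u u
    rw [mem_weak] at hu hw
    omega
  · exact h1

/-- A weak vertex has at most one weak neighbour. -/
theorem not_mem_weak_of_adj (h : LocallyBalanced R a b) {u w u' : V} (hu : u ∈ weak a b)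
    (hw : w ∈ weak a b) (hne : u ≠ u') (huw : R.Adj w u) (huw' : R.Adj w u') : u' ∉ weak a b := by
  intro hu'
  -- Three weak vertices on a path would gain at least `3 - 6 + 4 = 1`.
  have hl : Linked R {u', u, w} :=
    ((linked_singleton w).insert_of_adj (by simp) huw).insert_of_adj (u := w) (by simp) huw'
  have h2 := h.gain_nonpos _ hl ((Finset.card_le_three).trans (by norm_num))
  have h3 : ∀ f : V → ℤ, ∑ v ∈ ({u', u, w} : Finset V), f v = f u' + (f u + f w) := fun f => by
    rw [Finset.sum_insert (by simp [hne.symm, huw'.ne.symm]), Finset.sum_pair huw.ne.symm]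
  simp only [gain, h3, ind_of_adj huw, ind_of_adj huw.symm, ind_of_adj huw',
    ind_of_adj huw'.symm] at h2
  have := h.ideg_of_mem_weak hu
  have := h.ideg_of_mem_weak hu'
  have := h.ideg_of_mem_weak hw
  have := ind_nonneg R w w
  have := ind_nonneg R u u
  have := ind_nonneg R u' u'
  have := ind_nonneg R u u'
  have := ind_nonneg R u' u
  rw [mem_weak] at hu hw hu'
  omega

/-- The contribution of a vertex of the halo to the gain. -/
theorem toll_mul_le (h : LocallyBalanced R a b) {S : Finset V} {w : V}
    (hw : w ∈ halo R a b S) :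
    toll R a b w * ∑ v ∈ S, ind R w v +
        (if toll R a b w = 1 ∧ 2 ≤ ∑ v ∈ S, ind R w v then 1 else 0) ≤
      a w - b w - ideg R w + 2 * ∑ v ∈ S, ind R w v + ∑ u ∈ halo R a b S, ind R w u := by
  have hww := halo_subset_weak S hw
  have hx0 : 0 ≤ ∑ v ∈ S, ind R w v := Finset.sum_nonneg fun _ _ => ind_nonneg _ _ _
  have hy0 : 0 ≤ ∑ u ∈ halo R a b S, ind R w u := Finset.sum_nonneg fun _ _ => ind_nonneg _ _ _
  have hy : ∀ u ∈ halo R a b S, R.Adj w u → 1 ≤ ∑ u ∈ halo R a b S, ind R w u := fun u hu hwu => by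
    rw [← ind_of_adj hwu]
    exact Finset.single_le_sum (f := fun u => ind R w u) (fun _ _ => ind_nonneg _ _ _) hu
  have hx : ∀ u ∈ S, R.Adj w u → 1 ≤ ∑ u ∈ S, ind R w u := fun u hu hwu => by
    rw [← ind_of_adj hwu]
    exact Finset.single_le_sum (f := fun u => ind R w u) (fun _ _ => ind_nonneg _ _ _) hu
  have hr := h.ideg_of_mem_weak hww
  have hab := mem_weak.1 hww
  rw [hab.1, hab.2]
  rcases Finset.mem_union.1 hw with hwf | hwf
  · obtain ⟨-, v, hv, hwv⟩ := mem_fringe.1 hwf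
    have := hx v hv hwv
    unfold toll
    split_ifs with h1 h2 h3
    · omega
    · have := h1.1
      omega
    · norm_num at h3
    · rcases hr with hr | hr
      · omega
      -- This case is why the halo has a second layer: the weak neighbour `u` of `w` need not be
      -- next to `S`, and including it saves the edge between them.
      · obtain ⟨u, hu, hwu⟩ : ∃ u ∈ weak a b, R.Adj w u := by
          by_contra! hcon
          exact h1 ⟨hr, hcon⟩
        have := hy u (Finset.mem_union_right _ (mem_fringe.2 ⟨hu, w, hwf, hwu.symm⟩)) hwu
        omega
  · obtain ⟨-, u, hu, hwu⟩ := mem_fringe.1 hwf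
    have := hy u (Finset.mem_union_left _ hu) hwu
    have ht : toll R a b w = 2 := by
      unfold toll
      rw [if_neg]
      exact fun h' => h'.2 u (mem_fringe.1 hu).1 hwu
    rw [ht]
    norm_num
    omega

/-- An edge between `S` and the halo stays cut and is credited at both ends. Credit it wholly to the
halo, which explains the factor 2 in `toll_mul_le`, and sum the contributions of the halo vertices.
-/
theorem le_gain_union_halo (h : LocallyBalanced R a b) {S : Finset V}
    (hS : Disjoint S (weak a b)) :
    gain R a b S + ∑ v ∈ S, ∑ w ∈ weak a b, ind R v w * toll R a b w +
        ∑ w ∈ halo R a b S, (if toll R a b w = 1 ∧ 2 ≤ ∑ v ∈ S, ind R w v then 1 else 0) ≤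
      gain R a b (S ∪ halo R a b S) := by
  set H := halo R a b S with hH
  have hd : Disjoint S H := Finset.disjoint_of_subset_right (halo_subset_weak S) hS
  have e1 : ∑ v ∈ S, ∑ w ∈ weak a b, ind R v w * toll R a b w =
      ∑ w ∈ H, toll R a b w * ∑ v ∈ S, ind R w v := by
    rw [Finset.sum_comm, ← Finset.sum_subset (halo_subset_weak S)]
    · refine Finset.sum_congr rfl fun w _ => ?_
      rw [Finset.mul_sum]
      exact Finset.sum_congr rfl fun v _ => by rw [ind_comm, mul_comm]
    · intro w hw hwH
      refine Finset.sum_eq_zero fun v hv => ?_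
      rw [ind_of_not_adj fun h' => hwH (mem_halo_of_adj hw hv h'.symm), zero_mul]
  have e2 : gain R a b (S ∪ H) = gain R a b S + ∑ w ∈ H, (a w - b w - ideg R w +
      2 * ∑ v ∈ S, ind R w v + ∑ u ∈ H, ind R w u) := by
    have e3 : ∑ v ∈ S, ∑ w ∈ H, ind R v w = ∑ w ∈ H, ∑ v ∈ S, ind R w v := by
      rw [Finset.sum_comm]
      exact Finset.sum_congr rfl fun w _ => Finset.sum_congr rfl fun v _ => ind_comm _ _ _
    simp only [gain, Finset.sum_union hd, Finset.sum_add_distrib, ← Finset.mul_sum, e3]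
    ring
  rw [e1, e2, add_assoc, ← Finset.sum_add_distrib]
  exact add_le_add_right (Finset.sum_le_sum fun w hw => h.toll_mul_le hw) _

theorem toll_le_of_card_le (h : LocallyBalanced R a b) {S : Finset V} (hl : Linked R S)
    (hS : Disjoint S (weak a b)) (hc : S.card ≤ 40) (hb : 4 ≤ S.card ∨ ∃ v ∈ S, b v ≠ 0) :
    ∑ v ∈ S, ∑ w ∈ weak a b, ind R v w * (2 * toll R a b w) ≤
      ∑ v ∈ S, (ideg R v + 6 * b v - 5 * a v) := by
  have h1 := h.le_gain_union_halo hS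
  have h2 := h.gain_nonpos _ (hl.union_halo subset_rfl) ((h.card_union_halo_le S).trans (by omega))
  have h3 : 0 ≤ ∑ w ∈ halo R a b S,
      (if toll R a b w = 1 ∧ 2 ≤ ∑ v ∈ S, ind R w v then 1 else 0 : ℤ) :=
    Finset.sum_nonneg fun w _ => by split_ifs <;> simp
  have h4 := hl.two_mul_card_le
  -- This is what remains of the claim once the edges inside `S` are bounded below by those of a
  -- spanning tree. By the degree bound each term is at least `1 + 5 * b v - 2 * a v`; as `a v ≤ b
  -- v`, this is at least 1, and at least 4 if `b v ≠ 0`.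
  have h5 : 4 ≤ ∑ v ∈ S, (4 - ideg R v + 4 * b v - 3 * a v) := by
    have hp : ∀ v ∈ S, 1 ≤ 4 - ideg R v + 4 * b v - 3 * a v := fun v hv => by
      have := h.left_le_right (Finset.disjoint_left.1 hS hv)
      have := h.degree_le v
      have := h.left_nonneg v
      have := h.left_le_one v
      omega
    rcases hb with hb | ⟨v, hv, hbv⟩
    · calc (4 : ℤ) ≤ S.card := by exact_mod_cast hb
        _ = ∑ v ∈ S, 1 := by simp
        _ ≤ _ := Finset.sum_le_sum hp
    · refine le_trans ?_ (Finset.single_le_sum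
        (f := fun v => 4 - ideg R v + 4 * b v - 3 * a v) (fun v hv => by linarith [hp v hv]) hv)
      have := h.left_le_right (Finset.disjoint_left.1 hS hv)
      have := h.degree_le v
      have := h.left_nonneg v
      have := h.left_le_one v
      have := h.right_nonneg v
      omega
  have e : ∑ v ∈ S, ∑ w ∈ weak a b, ind R v w * (2 * toll R a b w) =
      2 * ∑ v ∈ S, ∑ w ∈ weak a b, ind R v w * toll R a b w := by
    simp only [Finset.mul_sum]
    exact Finset.sum_congr rfl fun v _ => Finset.sum_congr rfl fun w _ => by ring
  rw [e]
  have hg : gain R a b S = ∑ v ∈ S, (a v - b v - ideg R v + ∑ w ∈ S, ind R v w) := rfl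
  replace h1 := h1.trans h2
  rw [hg] at h1
  simp only [Finset.sum_add_distrib, Finset.sum_sub_distrib, ← Finset.mul_sum, Finset.sum_const,
    nsmul_eq_mul] at *
  linarith

/-- Both sides are additive over disjoint pieces, so large sets are split until all pieces have
between 4 and 40 vertices. -/
theorem toll_le (h : LocallyBalanced R a b) {S : Finset V} (hl : Linked R S)
    (hS : Disjoint S (weak a b)) (hc : 4 ≤ S.card) :
    ∑ v ∈ S, ∑ w ∈ weak a b, ind R v w * (2 * toll R a b w) ≤
      ∑ v ∈ S, (ideg R v + 6 * b v - 5 * a v) := by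
  classical
  induction hn : S.card using Nat.strong_induction_on generalizing S with
  | _ n ih =>
    subst hn
    by_cases hc' : S.card ≤ 40
    · exact h.toll_le_of_card_le hl hS hc' (Or.inl hc)
    · obtain ⟨W, hWS, hWl, hW4, hWl', hW4'⟩ := hl.exists_split (fun u =>
        ⟨Finset.univ.filter fun w => R.Adj u w, by
          have := h.ideg_le u
          rw [ideg_eq_card] at this
          exact_mod_cast this, fun v hv => by simpa using hv⟩) (by omega)
      have hcard := Finset.card_sdiff_add_card_eq_card hWS
      rw [← Finset.sum_sdiff hWS, ← Finset.sum_sdiff hWS]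
      exact add_le_add
        (ih _ (by omega) hWl' (Finset.disjoint_of_subset_left Finset.sdiff_subset hS) hW4' rfl)
        (ih _ (by omega) hWl (Finset.disjoint_of_subset_left hWS hS) hW4 rfl)

end LocallyBalanced

/-! ### Small components without edges of the second kind -/

/-- `S` has no weak vertex, and no edge to another vertex that is not weak. -/
def StrongClosed (R : SimpleGraph V) (a b : V → ℤ) (S : Finset V) : Prop :=
  Disjoint S (weak a b) ∧ ∀ u ∈ S, ∀ v ∉ weak a b, v ∉ S → ¬ R.Adj u v

/-- `S` is a small component of the graph of the vertices that are not weak, and none of them meets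
an edge of the second kind. -/
structure Tight (R : SimpleGraph V) (a b : V → ℤ) (S : Finset V) : Prop where
  linked : Linked R S
  closed : StrongClosed R a b S
  card_le : S.card ≤ 3
  right_eq_zero : ∀ v ∈ S, b v = 0

namespace LocallyBalanced

/-- On `S` both `a` and `b` vanish, so `gain R a b S` is minus the number of edges from `S` to weak
vertices. The tolls already compensate this, each being at least 1; a toll of 2, or a weak vertex
with two edges to `S`, would make the gain positive. The set `T` only certifies that `S` becomes
connected once its halo is added, so `S` may be a union of two components. -/
theorem toll_eq_one_of_linked (h : LocallyBalanced R a b) {S T : Finset V}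
    (hS : StrongClosed R a b S) (hb : ∀ v ∈ S, b v = 0) (hc : S.card ≤ 6) (hT : Linked R T)
    (hST : S ⊆ T) (hTS : T ⊆ S ∪ halo R a b S) {v w : V} (hv : v ∈ S) (hw : w ∈ weak a b)
    (hvw : R.Adj w v) : toll R a b w = 1 ∧ ∑ v ∈ S, ind R w v ≤ 1 := by
  have e : T ∪ halo R a b S = S ∪ halo R a b S :=
    Finset.Subset.antisymm (Finset.union_subset hTS Finset.subset_union_right)
      (Finset.union_subset_union_left hST)
  have h1 := h.le_gain_union_halo hS.1
  have h2 := h.gain_nonpos _ (hT.union_halo (a := a) (b := b) hST) (by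
    rw [e]
    exact (h.card_union_halo_le S).trans (by omega))
  rw [e] at h2
  have h3 : ∀ v ∈ S, ideg R v = ∑ u ∈ S, ind R v u + ∑ w ∈ weak a b, ind R v w := fun v hv => by
    rw [← Finset.sum_union hS.1, ideg]
    symm
    refine Finset.sum_subset (Finset.subset_univ _) fun u _ hu => ind_of_not_adj ?_
    simp only [Finset.mem_union, not_or] at hu
    exact hS.2 v hv u hu.2 hu.1
  have h4 : gain R a b S = -∑ v ∈ S, ∑ w ∈ weak a b, ind R v w := by
    rw [gain, ← Finset.sum_neg_distrib]
    refine Finset.sum_congr rfl fun v hv => ?_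
    have := h.left_le_right (Finset.disjoint_left.1 hS.1 hv)
    have := h.left_nonneg v
    have := hb v hv
    have := h3 v hv
    linarith
  have h5 : ∀ v ∈ S, ∀ w ∈ weak a b, 0 ≤ ind R v w * toll R a b w - ind R v w := fun v _ w _ => by
    have := ind_nonneg R v w
    rcases toll_eq R a b w with h | h <;> rw [h] <;> linarith
  have h6 : ∑ v ∈ S, ∑ w ∈ weak a b, (ind R v w * toll R a b w - ind R v w) +
      ∑ w ∈ halo R a b S,
        (if toll R a b w = 1 ∧ 2 ≤ ∑ v ∈ S, ind R w v then 1 else 0 : ℤ) ≤ 0 := by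
    simp only [Finset.sum_sub_distrib]
    linarith
  have h7 : ∀ w, (0 : ℤ) ≤ (if toll R a b w = 1 ∧ 2 ≤ ∑ v ∈ S, ind R w v then 1 else 0) :=
    fun w => by split_ifs <;> simp
  have h8 : 0 ≤ ∑ v ∈ S, ∑ w ∈ weak a b, (ind R v w * toll R a b w - ind R v w) :=
    Finset.sum_nonneg fun v hv => Finset.sum_nonneg (h5 v hv)
  have h9 := Finset.single_le_sum (fun w _ => h7 w) (mem_halo_of_adj hw hv hvw)
  have h10 : ind R v w * toll R a b w - ind R v w ≤
      ∑ v ∈ S, ∑ w ∈ weak a b, (ind R v w * toll R a b w - ind R v w) :=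
    (Finset.single_le_sum (h5 v hv) hw).trans (Finset.single_le_sum
      (f := fun v => ∑ w ∈ weak a b, (ind R v w * toll R a b w - ind R v w))
      (fun v hv => Finset.sum_nonneg (h5 v hv)) hv)
  have h11 : 0 ≤ ∑ w ∈ halo R a b S,
      (if toll R a b w = 1 ∧ 2 ≤ ∑ v ∈ S, ind R w v then 1 else 0 : ℤ) :=
    Finset.sum_nonneg fun w _ => h7 w
  rw [ind_of_adj hvw.symm] at h10
  have h12 : toll R a b w = 1 := by
    rcases toll_eq R a b w with h | h
    · exact h
    · rw [h] at h10
      linarith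
  refine ⟨h12, ?_⟩
  by_contra! hcon
  rw [if_pos ⟨h12, hcon⟩] at h9
  linarith

theorem toll_eq_one (h : LocallyBalanced R a b) {K : Finset V} (hK : Tight R a b K) {v w : V}
    (hv : v ∈ K) (hw : w ∈ weak a b) (hvw : R.Adj w v) : toll R a b w = 1 :=
  (h.toll_eq_one_of_linked hK.closed hK.right_eq_zero (hK.card_le.trans (by norm_num)) hK.linked
    subset_rfl Finset.subset_union_left hv hw hvw).1

/-- The common weak neighbour `w` joins `K` and `K'` into a connected set, so `w` has at most one
edge to `K ∪ K'`. The case `K = K'` is included. -/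
theorem eq_of_tight (h : LocallyBalanced R a b) {K K' : Finset V} (hK : Tight R a b K)
    (hK' : Tight R a b K') {v v' w : V} (hv : v ∈ K) (hv' : v' ∈ K') (hw : w ∈ weak a b)
    (hvw : R.Adj w v) (hvw' : R.Adj w v') : v = v' := by
  by_contra hne
  have hS : StrongClosed R a b (K ∪ K') := by
    refine ⟨Finset.disjoint_union_left.2 ⟨hK.closed.1, hK'.closed.1⟩, fun u hu x hx hxK => ?_⟩
    simp only [Finset.mem_union, not_or] at hu hxK
    rcases hu with hu | hu
    · exact hK.closed.2 u hu x hx hxK.1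
    · exact hK'.closed.2 u hu x hx hxK.2
  have hT : Linked R (insert w K ∪ K') :=
    (hK.linked.insert_of_adj hv hvw.symm).union_of_adj hK'.linked (by simp) hv' hvw'
  have hwH : w ∈ halo R a b (K ∪ K') := mem_halo_of_adj hw (Finset.mem_union_left _ hv) hvw
  have h1 := (h.toll_eq_one_of_linked hS (fun u hu => by
      rcases Finset.mem_union.1 hu with hu | hu
      · exact hK.right_eq_zero u hu
      · exact hK'.right_eq_zero u hu)
    ((Finset.card_union_le _ _).trans (by linarith [hK.card_le, hK'.card_le])) hT
    (Finset.union_subset_union_left (Finset.subset_insert _ _))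
    (by
      rw [Finset.insert_union]
      exact Finset.insert_subset (Finset.mem_union_right _ hwH) Finset.subset_union_left)
    (Finset.mem_union_left _ hv) hw hvw).2
  have h2 : ∑ u ∈ ({v, v'} : Finset V), ind R w u ≤ ∑ u ∈ K ∪ K', ind R w u :=
    Finset.sum_le_sum_of_subset_of_nonneg (by
      intro x hx
      simp only [Finset.mem_insert, Finset.mem_singleton] at hx
      rcases hx with rfl | rfl <;> simp [hv, hv']) fun _ _ _ => ind_nonneg _ _ _
  rw [Finset.sum_pair hne, ind_of_adj hvw, ind_of_adj hvw'] at h2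
  linarith

end LocallyBalanced

/-! ### Payments to the weak vertices -/

open scoped Classical in
/-- What `v` pays for an edge to the weak vertex `w`. -/
noncomputable def payment (R : SimpleGraph V) (a b : V → ℤ) (v w : V) : ℤ :=
  if ∃ K, Tight R a b K ∧ v ∈ K then 1 else 2 * toll R a b w

theorem one_le_payment (R : SimpleGraph V) (a b : V → ℤ) (v w : V) : 1 ≤ payment R a b v w := by
  unfold payment
  split_ifs
  · rfl
  · rcases toll_eq R a b w with h | h <;> rw [h] <;> norm_num

namespace LocallyBalanced

/-- In a tight component `a` and `b` vanish, so the surplus of a vertex is its degree and covers 1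
per edge. Otherwise no vertex of `K` lies in a tight component, by uniqueness of components, and the
toll bounds apply. -/
theorem payment_le_of_linked (h : LocallyBalanced R a b) {K : Finset V} (hl : Linked R K)
    (hK : StrongClosed R a b K) :
    ∑ v ∈ K, ∑ w ∈ weak a b, ind R v w * payment R a b v w ≤
      ∑ v ∈ K, (ideg R v + 6 * b v - 5 * a v) := by
  by_cases ht : Tight R a b K
  · refine Finset.sum_le_sum fun v hv => ?_
    have h1 : ∀ w, payment R a b v w = 1 := fun w => by
      rw [payment, if_pos ⟨K, ht, hv⟩]
    have := h.left_le_right (Finset.disjoint_left.1 hK.1 hv)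
    have := h.left_nonneg v
    have := ht.right_eq_zero v hv
    have := sum_ind_le_ideg R v (weak a b)
    simp only [h1, mul_one]
    linarith
  · have h1 : ∀ v ∈ K, ∀ w, payment R a b v w = 2 * toll R a b w := fun v hv w => by
      rw [payment, if_neg]
      rintro ⟨K', hK', hv'⟩
      have e : K = K' := Finset.Subset.antisymm
        (hl.subset_of_closed hv hv' fun x hx y hy hy' =>
          hK'.closed.2 x hx y (Finset.disjoint_left.1 hK.1 hy) hy')
        (hK'.linked.subset_of_closed hv' hv fun x hx y hy hy' =>
          hK.2 x hx y (Finset.disjoint_left.1 hK'.closed.1 hy) hy')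
      exact ht (e ▸ hK')
    rw [Finset.sum_congr rfl fun v hv => Finset.sum_congr rfl fun w _ => by rw [h1 v hv w]]
    by_cases hc : 4 ≤ K.card
    · exact h.toll_le hl hK.1 hc
    · refine h.toll_le_of_card_le hl hK.1 (by omega) (Or.inr ?_)
      by_contra! hcon
      exact ht ⟨hl, hK, by omega, hcon⟩

theorem payment_le (h : LocallyBalanced R a b) {U : Finset V} (hU : StrongClosed R a b U) :
    ∑ v ∈ U, ∑ w ∈ weak a b, ind R v w * payment R a b v w ≤
      ∑ v ∈ U, (ideg R v + 6 * b v - 5 * a v) := by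
  induction hn : U.card using Nat.strong_induction_on generalizing U with
  | _ n ih =>
    subst hn
    rcases U.eq_empty_or_nonempty with rfl | ⟨x, hx⟩
    · simp
    obtain ⟨K, hKU, hxK, hl, hcl⟩ := exists_linked_component R U hx
    have hK : StrongClosed R a b K :=
      ⟨Finset.disjoint_of_subset_left hKU hU.1, fun u hu v hv hvK huv => by
        by_cases hvU : v ∈ U
        · exact hcl u hu v hvU hvK huv
        · exact hU.2 u (hKU hu) v hv hvU huv⟩
    have hUK : StrongClosed R a b (U \ K) :=
      ⟨Finset.disjoint_of_subset_left Finset.sdiff_subset hU.1, fun u hu v hv hvK huv => by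
        rw [Finset.mem_sdiff] at hu hvK
        by_cases hvU : v ∈ U
        · have : v ∈ K := by
            by_contra hv'
            exact hvK ⟨hvU, hv'⟩
          exact hcl v this u hu.1 hu.2 huv.symm
        · exact hU.2 u hu.1 v hv hvU huv⟩
    have hcard := Finset.card_sdiff_add_card_eq_card hKU
    have hpos := hl.1.card_pos
    rw [← Finset.sum_sdiff hKU, ← Finset.sum_sdiff hKU]
    exact add_le_add (ih _ (by omega) hUK rfl) (h.payment_le_of_linked hl hK)

/-- A toll of 2 excludes tight payers, so one such edge already yields 4. In the remaining case `w`
has two neighbours that are not weak and needs 3: each pays 1 or 2, and they are not both in tight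
components. -/
theorem le_payment (h : LocallyBalanced R a b) {w : V} (hw : w ∈ weak a b) :
    5 - ideg R w ≤ ∑ v ∈ (weak a b)ᶜ, ind R v w * payment R a b v w := by
  have hnn : ∀ v ∈ (weak a b)ᶜ, 0 ≤ ind R v w * payment R a b v w := fun v _ =>
    mul_nonneg (ind_nonneg _ _ _) (by linarith [one_le_payment R a b v w])
  have hfour : ∀ v ∉ weak a b, R.Adj w v → toll R a b w = 2 →
      4 ≤ ∑ v ∈ (weak a b)ᶜ, ind R v w * payment R a b v w := fun v hv hwv ht => by
    refine le_trans ?_ (Finset.single_le_sum hnn (Finset.mem_compl.2 hv))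
    rw [ind_of_adj hwv.symm, payment, if_neg, ht]
    · norm_num
    · rintro ⟨K, hK, hvK⟩
      rw [h.toll_eq_one hK hvK hw hwv] at ht
      norm_num at ht
  rcases h.ideg_of_mem_weak hw with hr | hr
  · obtain ⟨u, hu⟩ := exists_adj_of_ideg_eq_one hr
    have huw : u ∉ weak a b := fun hu' => by
      have := h.ideg_eq_two_of_adj_weak hu' hw hu
      omega
    have := hfour u huw hu (by
      rw [toll, if_neg]
      rintro ⟨h1, -⟩
      omega)
    omega
  · obtain ⟨u₁, u₂, hne, h₁, h₂, hall⟩ := exists_adj_of_ideg_eq_two hr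
    by_cases hw₁ : u₁ ∈ weak a b
    · have := hfour u₂ (h.not_mem_weak_of_adj hw₁ hw hne h₁ h₂) h₂ (by
        rw [toll, if_neg]
        exact fun h' => h'.2 u₁ hw₁ h₁)
      omega
    by_cases hw₂ : u₂ ∈ weak a b
    · have := hfour u₁ (h.not_mem_weak_of_adj hw₂ hw hne.symm h₂ h₁) h₁ (by
        rw [toll, if_neg]
        exact fun h' => h'.2 u₂ hw₂ h₂)
      omega
    have ht : toll R a b w = 1 := by
      rw [toll, if_pos]
      refine ⟨hr, fun u hu hwu => ?_⟩
      rcases hall u hwu with rfl | rfl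
      · exact hw₁ hu
      · exact hw₂ hu
    have hsub : ∑ v ∈ ({u₁, u₂} : Finset V), ind R v w * payment R a b v w ≤
        ∑ v ∈ (weak a b)ᶜ, ind R v w * payment R a b v w :=
      Finset.sum_le_sum_of_subset_of_nonneg (by
        intro x hx
        simp only [Finset.mem_insert, Finset.mem_singleton] at hx
        rcases hx with rfl | rfl <;> simpa) fun v hv _ => hnn v hv
    rw [Finset.sum_pair hne, ind_of_adj h₁.symm, ind_of_adj h₂.symm, one_mul, one_mul] at hsub
    refine le_trans ?_ hsub
    have p₁ := one_le_payment R a b u₁ w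
    have p₂ := one_le_payment R a b u₂ w
    by_cases ht₁ : ∃ K, Tight R a b K ∧ u₁ ∈ K
    · by_cases ht₂ : ∃ K, Tight R a b K ∧ u₂ ∈ K
      · obtain ⟨K₁, hK₁, hu₁⟩ := ht₁
        obtain ⟨K₂, hK₂, hu₂⟩ := ht₂
        exact absurd (h.eq_of_tight hK₁ hK₂ hu₁ hu₂ hw h₁ h₂) hne
      · have : payment R a b u₂ w = 2 := by rw [payment, if_neg ht₂, ht]; norm_num
        omega
    · have : payment R a b u₁ w = 2 := by rw [payment, if_neg ht₁, ht]; norm_num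
      omega

theorem sum_nonneg (h : LocallyBalanced R a b) : 0 ≤ ∑ v, (ideg R v + 6 * b v - 5 * a v) := by
  have h1 := h.payment_le (U := (weak a b)ᶜ) ⟨disjoint_compl_left, fun u _ v hv hv' =>
    absurd (Finset.mem_compl.2 hv) hv'⟩
  have h2 : ∑ w ∈ weak a b, (5 - ideg R w) ≤
      ∑ w ∈ weak a b, ∑ v ∈ (weak a b)ᶜ, ind R v w * payment R a b v w :=
    Finset.sum_le_sum fun w hw => h.le_payment hw
  rw [Finset.sum_comm] at h2
  have h3 : ∑ v ∈ weak a b, (ideg R v + 6 * b v - 5 * a v) = -∑ w ∈ weak a b, (5 - ideg R w) := by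
    rw [← Finset.sum_neg_distrib]
    refine Finset.sum_congr rfl fun v hv => ?_
    rw [(mem_weak.1 hv).1, (mem_weak.1 hv).2]
    ring
  rw [← Finset.sum_add_sum_compl (weak a b), h3]
  linarith

end LocallyBalanced

end Discharging

theorem Linked.mono {V : Type*} {R G : SimpleGraph V} (h : R ≤ G) {S : Finset V} (hS : Linked R S) :
    Linked G S := by
  refine ⟨hS.1, fun T hT hne hT' => ?_⟩
  obtain ⟨u, hu, v, hv, hvT, huv⟩ := hS.2 T hT hne hT'
  exact ⟨u, hu, v, hv, hvT, h huv⟩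

theorem exists_cutSize_eq_maxCut {V : Type*} [Fintype V] (G : SimpleGraph V) : ∃ B, maxCut G = cutSize G B := by
  obtain ⟨B, -, hB⟩ := Finset.exists_mem_eq_sup Finset.univ ⟨∅, Finset.mem_univ _⟩ (cutSize G)
  exact ⟨B, hB⟩

/-! ### From cuts to the vertex inequalities -/

section Flips

variable {V : Type*} [DecidableEq V]

/-- The sign with which an edge `uv` counts when just one of its endpoints is flipped. -/
noncomputable def flipSign (G : SimpleGraph V) (A : Finset V) (u v : V) : ℤ :=
  ind G u v * if (u ∈ A ↔ v ∈ A) then 1 else -1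

theorem flipSign_comm (G : SimpleGraph V) (A : Finset V) (u v : V) :
    flipSign G A u v = flipSign G A v u := by
  simp only [flipSign, ind_comm G u v, iff_comm (a := u ∈ A)]

/-- The edges that are cut both by `A` and by `B`. -/
def bothCut (G : SimpleGraph V) (A B : Finset V) : SimpleGraph V where
  Adj u v := G.Adj u v ∧ ¬ (u ∈ A ↔ v ∈ A) ∧ ¬ (u ∈ B ↔ v ∈ B)
  symm := ⟨fun u v h => ⟨h.1.symm, by rw [iff_comm]; exact h.2.1, by rw [iff_comm]; exact h.2.2⟩⟩

theorem bothCut_le {V : Type*} (G : SimpleGraph V) (A B : Finset V) : bothCut G A B ≤ G :=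
  fun _ _ h => h.1

/-- The indicator of the edges that are cut by `B` and not by `A`. -/
noncomputable def missed (G : SimpleGraph V) (A B : Finset V) (u v : V) : ℤ :=
  ind G u v * if (u ∈ A ↔ v ∈ A) ∧ ¬ (u ∈ B ↔ v ∈ B) then 1 else 0

theorem missed_nonneg (G : SimpleGraph V) (A B : Finset V) (u v : V) : 0 ≤ missed G A B u v := by
  have := ind_nonneg G u v
  unfold missed
  split_ifs <;> simp [this]

theorem ind_bothCut (G : SimpleGraph V) (A B : Finset V) (u v : V) : ind (bothCut G A B) u v =
    ind G u v * if ¬ (u ∈ A ↔ v ∈ A) ∧ ¬ (u ∈ B ↔ v ∈ B) then 1 else 0 := by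
  unfold ind bothCut
  by_cases h : G.Adj u v <;> simp [h]

theorem Linked.same_side {G : SimpleGraph V} {A B T : Finset V} (hT : Linked (bothCut G A B) T)
    {u v : V} (hu : u ∈ T) (hv : v ∈ T) : (u ∈ A ↔ v ∈ A) ↔ (u ∈ B ↔ v ∈ B) := by
  classical
  have := hT.subset_of_closed (U := T.filter fun w => (u ∈ A ↔ w ∈ A) ↔ (u ∈ B ↔ w ∈ B)) hu
    (by simp [hu]) (fun x hx y hy hy' hxy => by
      have h1 := hxy.2.1
      have h2 := hxy.2.2
      simp only [Finset.mem_filter] at hx hy'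
      tauto)
  simpa [hv] using this hv

variable [Fintype V]

theorem sum_boundary (E : V → V → ℤ) (hE : ∀ u v, E u v = E v u) (T : Finset V) :
    ∑ u, ∑ v, E u v * (if (u ∈ T ↔ v ∈ T) then 0 else 1) = 2 * ∑ u ∈ T, ∑ v ∈ Tᶜ, E u v := by
  have h1 : ∀ u ∈ T, ∑ v, E u v * (if (u ∈ T ↔ v ∈ T) then 0 else 1) = ∑ v ∈ Tᶜ, E u v :=
    fun u hu => by
      rw [← Finset.sum_add_sum_compl T, Finset.sum_eq_zero, zero_add]
      · refine Finset.sum_congr rfl fun v hv => ?_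
        rw [Finset.mem_compl] at hv
        simp [hu, hv]
      · intro v hv
        simp [hu, hv]
  have h2 : ∀ u ∈ Tᶜ, ∑ v, E u v * (if (u ∈ T ↔ v ∈ T) then 0 else 1) = ∑ v ∈ T, E u v :=
    fun u hu => by
      rw [Finset.mem_compl] at hu
      rw [← Finset.sum_add_sum_compl T, Finset.sum_eq_zero (s := Tᶜ), add_zero]
      · refine Finset.sum_congr rfl fun v hv => ?_
        simp [hu, hv]
      · intro v hv
        rw [Finset.mem_compl] at hv
        simp [hu, hv]
  rw [← Finset.sum_add_sum_compl T, Finset.sum_congr rfl h1, Finset.sum_congr rfl h2,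
    Finset.sum_comm (s := Tᶜ)]
  simp only [fun u v => hE v u]
  ring

theorem cutSize_eq_sum (G : SimpleGraph V) (A : Finset V) :
    (cutSize G A : ℤ) = ∑ u ∈ A, ∑ v ∈ Aᶜ, ind G u v := by
  classical
  have h1 : edgesBetween G (A : Set V) (A : Set V)ᶜ =
      (fun p : V × V => s(p.1, p.2)) '' ((A ×ˢ Aᶜ).filter fun p => G.Adj p.1 p.2 : Finset (V × V)) := by
    ext e
    simp only [edgesBetween, Set.mem_ofPred_eq, Finset.coe_filter, Finset.mem_product,
      Finset.mem_compl, Set.mem_image, Prod.exists, Set.mem_compl_iff, Finset.mem_coe]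
    constructor
    · rintro ⟨he, u, hu, v, hv, rfl⟩
      exact ⟨u, v, ⟨⟨hu, hv⟩, by simpa using he⟩, rfl⟩
    · rintro ⟨u, v, ⟨⟨hu, hv⟩, he⟩, rfl⟩
      exact ⟨by simpa using he, u, hu, v, hv, rfl⟩
  rw [cutSize, h1, Set.InjOn.ncard_image, Set.ncard_coe_finset, Finset.card_filter,
    Finset.sum_product]
  · simp [ind]
  · rintro ⟨u, v⟩ h ⟨u', v'⟩ h' heq
    simp only [Finset.coe_filter, Finset.mem_product, Finset.mem_compl, Set.mem_ofPred_eq] at h h'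
    simp only [Sym2.eq_iff] at heq
    rcases heq with ⟨rfl, rfl⟩ | ⟨rfl, rfl⟩
    · rfl
    · exact absurd h'.1.1 h.1.2

theorem two_mul_cutSize (G : SimpleGraph V) (A : Finset V) :
    2 * (cutSize G A : ℤ) = ∑ u, ∑ v, ind G u v * (if (u ∈ A ↔ v ∈ A) then 0 else 1) := by
  rw [cutSize_eq_sum, sum_boundary _ (ind_comm G)]

theorem cutSize_symmDiff (G : SimpleGraph V) (A T : Finset V) :
    (cutSize G (symmDiff A T) : ℤ) = cutSize G A + ∑ u ∈ T, ∑ v ∈ Tᶜ, flipSign G A u v := by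
  have h1 := two_mul_cutSize G (symmDiff A T)
  have h2 := two_mul_cutSize G A
  have h3 := sum_boundary _ (flipSign_comm G A) T
  have h4 : ∑ u, ∑ v, ind G u v * (if (u ∈ symmDiff A T ↔ v ∈ symmDiff A T) then 0 else 1 : ℤ) =
      ∑ u, ∑ v, ind G u v * (if (u ∈ A ↔ v ∈ A) then 0 else 1) +
        ∑ u, ∑ v, flipSign G A u v * (if (u ∈ T ↔ v ∈ T) then 0 else 1) := by
    simp only [← Finset.sum_add_distrib]
    refine Finset.sum_congr rfl fun u _ => Finset.sum_congr rfl fun v _ => ?_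
    simp only [flipSign, Finset.mem_symmDiff]
    by_cases h1 : u ∈ A <;> by_cases h2 : v ∈ A <;> by_cases h3 : u ∈ T <;> by_cases h4 : v ∈ T <;>
      simp [h1, h2, h3, h4]
  linarith

/-- Edges inside `T` cut by only one of `A` and `B` do not exist. Equality may fail because edges
leaving `T` that neither cuts become cut, which `gain` ignores. -/
theorem gain_le_of_linked {G : SimpleGraph V} {A B T : Finset V} (hT : Linked (bothCut G A B) T) :
    gain (bothCut G A B) (fun u => ∑ v, missed G A B u v) (fun u => ∑ v, missed G B A u v) T ≤
      ∑ u ∈ T, ∑ v ∈ Tᶜ, flipSign G A u v := by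
  refine Finset.sum_le_sum fun u hu => ?_
  have h0 : ∀ v ∈ T, missed G A B u v = 0 ∧ missed G B A u v = 0 := fun v hv => by
    have := hT.same_side hu hv
    unfold missed
    constructor <;> (rw [if_neg (by tauto), mul_zero])
  have h1 : ∑ v ∈ T, missed G A B u v = 0 := Finset.sum_eq_zero fun v hv => (h0 v hv).1
  have h2 : ∑ v ∈ T, missed G B A u v = 0 := Finset.sum_eq_zero fun v hv => (h0 v hv).2
  have h3 : ∑ v ∈ Tᶜ, (missed G A B u v - missed G B A u v - ind (bothCut G A B) u v) ≤
      ∑ v ∈ Tᶜ, flipSign G A u v := by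
    refine Finset.sum_le_sum fun v _ => ?_
    have := ind_nonneg G u v
    rw [ind_bothCut]
    unfold missed flipSign
    by_cases h1 : (u ∈ A ↔ v ∈ A) <;> by_cases h2 : (u ∈ B ↔ v ∈ B) <;> simp [h1, h2, this]
  simp only [Finset.sum_sub_distrib] at h3
  simp only [ideg]
  rw [← Finset.sum_add_sum_compl T, ← Finset.sum_add_sum_compl T (fun v => missed G B A u v),
    ← Finset.sum_add_sum_compl T (fun v => ind (bothCut G A B) u v), h1, h2]
  linarith

/-- A cut of a subcubic graph that no flip of a small connected set improves has at least `5 / 6`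
of the maximum size. -/
theorem five_mul_maxCut_le {G : SimpleGraph V} (hG : ∀ v, ideg G v ≤ 3) {A : Finset V}
    (hA : ∀ T, Linked G T → T.card ≤ 520 → cutSize G (symmDiff A T) ≤ cutSize G A) :
    5 * maxCut G ≤ 6 * cutSize G A := by
  obtain ⟨B, hB⟩ := exists_cutSize_eq_maxCut G
  have hbal : LocallyBalanced (bothCut G A B) (fun u => ∑ v, missed G A B u v)
      (fun u => ∑ v, missed G B A u v) := by
    refine ⟨fun v => Finset.sum_nonneg fun _ _ => missed_nonneg _ _ _ _ _,
      fun v => Finset.sum_nonneg fun _ _ => missed_nonneg _ _ _ _ _, fun v => ?_,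
      fun T hT hc => ?_⟩
    · refine le_trans ?_ (hG v)
      simp only [ideg, ← Finset.sum_add_distrib]
      refine Finset.sum_le_sum fun w _ => ?_
      have := ind_nonneg G v w
      rw [ind_bothCut]
      unfold missed
      by_cases h1 : (v ∈ A ↔ w ∈ A) <;> by_cases h2 : (v ∈ B ↔ w ∈ B) <;> simp [h1, h2, this]
    · have h1 := hA T (hT.mono (bothCut_le G A B)) hc
      have h2 := cutSize_symmDiff G A T
      have h3 := gain_le_of_linked hT
      have h4 : (cutSize G (symmDiff A T) : ℤ) ≤ cutSize G A := by exact_mod_cast h1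
      linarith
  have h := hbal.sum_nonneg
  have hcA := two_mul_cutSize G A
  have hcB := two_mul_cutSize G B
  -- An edge cut by both contributes `6 - 5 = 1`, one cut only by `A` contributes 6, one cut only by
  -- `B` contributes -5, and each is counted at both ends.
  have key : 6 * (2 * (cutSize G A : ℤ)) - 5 * (2 * (cutSize G B : ℤ)) =
      ∑ u, (ideg (bothCut G A B) u + 6 * ∑ v, missed G B A u v - 5 * ∑ v, missed G A B u v) := by
    rw [hcA, hcB]
    simp only [ideg, Finset.mul_sum, ← Finset.sum_sub_distrib, ← Finset.sum_add_distrib]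
    refine Finset.sum_congr rfl fun u _ => Finset.sum_congr rfl fun v _ => ?_
    rw [ind_bothCut]
    unfold missed
    by_cases h1 : (u ∈ A ↔ v ∈ A) <;> by_cases h2 : (u ∈ B ↔ v ∈ B) <;> simp [h1, h2]
    ring
  rw [hB]
  have : (5 * cutSize G B : ℤ) ≤ 6 * cutSize G A := by linarith
  exact_mod_cast this

end Flips

end MaxCut

/-! ### Running time of loop-free programs and of simple loops -/

namespace RAM

/-- Programs without loops. -/
def Prog.LoopFree : Prog → Prop
  | .skip => True
  | .assign _ _ => True
  | .write _ _ _ => True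
  | .seq p q => p.LoopFree ∧ q.LoopFree
  | .ite _ p q => p.LoopFree ∧ q.LoopFree
  | .loop _ _ => False

open scoped Classical in
/-- The final state of a program without loops. -/
noncomputable def Prog.run : Prog → State → State
  | .skip, s => s
  | .assign x e, s => s.setReg x (e.eval s)
  | .write a i e, s => s.setArr a (i.eval s) (e.eval s)
  | .seq p q, s => q.run (p.run s)
  | .ite b p q, s => if b.Holds s then p.run s else q.run s
  | .loop _ _, s => s

theorem Prog.run_ite_of_holds {b : Test} {s : State} (h : b.Holds s) (p q : Prog) :
    (Prog.ite b p q).run s = p.run s := if_pos h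

theorem Prog.run_ite_of_not_holds {b : Test} {s : State} (h : ¬ b.Holds s) (p q : Prog) :
    (Prog.ite b p q).run s = q.run s := if_neg h

/-- A bound for the number of steps of a program without loops. -/
def Prog.maxCost : Prog → ℕ
  | .skip => 1
  | .assign _ e => e.cost + 1
  | .write _ i e => i.cost + e.cost + 1
  | .seq p q => p.maxCost + q.maxCost
  | .ite b p q => b.cost + 1 + max p.maxCost q.maxCost
  | .loop _ _ => 0

theorem Prog.LoopFree.exec {p : Prog} (hp : p.LoopFree) (s : State) :
    ∃ t ≤ p.maxCost, Exec p s (p.run s) t := by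
  induction p generalizing s with
  | skip => exact ⟨_, le_rfl, .skip s⟩
  | assign x e => exact ⟨_, le_rfl, .assign s x e⟩
  | write a i e => exact ⟨_, le_rfl, .write s a i e⟩
  | seq p q ihp ihq =>
    obtain ⟨t, ht, h⟩ := ihp hp.1 s
    obtain ⟨t', ht', h'⟩ := ihq hp.2 (p.run s)
    exact ⟨_, add_le_add ht ht', .seq h h'⟩
  | ite b p q ihp ihq =>
    by_cases hb : b.Holds s
    · obtain ⟨t, ht, h⟩ := ihp hp.1 s
      refine ⟨b.cost + 1 + t, ?_, ?_⟩
      · simp only [Prog.maxCost]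
        have := le_max_left p.maxCost q.maxCost
        omega
      · rw [Prog.run, if_pos hb]
        exact .ite_true hb h
    · obtain ⟨t, ht, h⟩ := ihq hp.2 s
      refine ⟨b.cost + 1 + t, ?_, ?_⟩
      · simp only [Prog.maxCost]
        have := le_max_right p.maxCost q.maxCost
        omega
      · rw [Prog.run, if_neg hb]
        exact .ite_false hb h
  | loop b p => exact hp.elim

/-- A loop with a loop-free body halts when an invariant is kept and a potential decreases. -/
theorem exec_loop {b : Test} {p : Prog} (hp : p.LoopFree) (Inv : State → Prop) (μ : State → ℕ)
    (h : ∀ s, Inv s → b.Holds s → Inv (p.run s) ∧ μ (p.run s) < μ s) (s : State) (hs : Inv s) :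
    ∃ s' t, Exec (.loop b p) s s' t ∧ t ≤ μ s * (b.cost + 1 + p.maxCost) + (b.cost + 1) ∧
      Inv s' ∧ ¬ b.Holds s' := by
  induction hn : μ s using Nat.strong_induction_on generalizing s with
  | _ m ih =>
    subst hn
    by_cases hb : b.Holds s
    · obtain ⟨h1, h2⟩ := h s hs hb
      obtain ⟨t, ht, he⟩ := hp.exec s
      obtain ⟨s', t', he', ht', hi, hb'⟩ := ih _ h2 _ h1 rfl
      refine ⟨s', _, .loop_true hb he he', ?_, hi, hb'⟩
      have := Nat.mul_le_mul_right (b.cost + 1 + p.maxCost) (Nat.succ_le_of_lt h2)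
      rw [Nat.succ_mul] at this
      omega
    · exact ⟨s, _, .loop_false hb, Nat.le_add_left _ _, hs, hb⟩

end RAM

namespace MaxCut

open RAM

/-- All lists of length at most `k` with entries in `l`. -/
def listsUpTo {α : Type*} (l : List α) : ℕ → List (List α)
  | 0 => [[]]
  | k + 1 => [] :: l.flatMap fun x => (listsUpTo l k).map (x :: ·)

theorem mem_listsUpTo {α : Type*} {l : List α} {k : ℕ} {m : List α} :
    m ∈ listsUpTo l k ↔ m.length ≤ k ∧ ∀ x ∈ m, x ∈ l := by
  induction k generalizing m with
  | zero => cases m <;> simp [listsUpTo]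
  | succ k ih =>
    cases m with
    | nil => simp [listsUpTo]
    | cons x m => simp [listsUpTo, ih, and_assoc, and_left_comm]

/-! ### The program -/

/-- The expression `e + j`. -/
def shift (e : Exp) : ℕ → Exp
  | 0 => e
  | j + 1 => .succ (shift e j)

/-- The entry `j` of the list of the vertex `e`. -/
def portExp (j : ℕ) (e : Exp) : Exp := .read 1 (shift (.read 0 e) j)

/-- The vertex that is reached from the vertex `e` along a list of ports. -/
def wordExp : List ℕ → Exp → Exp
  | [], e => e
  | j :: w, e => wordExp w (portExp j e)

/-- Compare the side of the vertex in register `5` with that of its neighbour `j`, if there is one,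
and count the outcome in register `3` or `4`. -/
def countPort (j : ℕ) : Prog :=
  .ite (.lt (shift (.read 0 (.reg 5)) j) (.read 0 (.succ (.reg 5))))
    (.ite (.eq (.read 2 (.reg 5)) (.read 2 (portExp j (.reg 5))))
      (.assign 3 (.succ (.reg 3))) (.assign 4 (.succ (.reg 4))))
    .skip

/-- Flip the vertex `e`, adding the edges that become cut to register `3`, and those that become
uncut to register `4`. -/
def flipVertex (e : Exp) : Prog :=
  .seq (.assign 5 e) (.seq (countPort 0) (.seq (countPort 1) (.seq (countPort 2)
    (.write 2 (.reg 5) (.sub (.const 1) (.read 2 (.reg 5)))))))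

/-- Flip the vertices that are reached from the vertex in register `2` along the given words. -/
def flipWords : List (List ℕ) → Prog
  | [] => .skip
  | w :: c => .seq (flipVertex (wordExp w (.reg 2))) (flipWords c)

/-- Push the vertices that are reached from the vertex in register `2` along the given words. -/
def pushWords : List (List ℕ) → Prog
  | [] => .skip
  | w :: c => .seq (.write 3 (.reg 1) (wordExp w (.reg 2)))
      (.seq (.assign 1 (.succ (.reg 1))) (pushWords c))

/-- The words of length at most `k`. -/
def words (k : ℕ) : List (List ℕ) := listsUpTo [0, 1, 2] k

/-- The empty word, and the words of `c`, continued by at most `k + 1` ports. -/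
def continuations (k : ℕ) (c : List (List ℕ)) : List (List ℕ) :=
  [] :: c.flatMap fun w => (words (k + 1)).map (w ++ ·)

/-- Flip the vertices given by `c`. If this improves the cut, push all vertices near them, and
otherwise flip them back. -/
def tryFlip (k : ℕ) (c : List (List ℕ)) : Prog :=
  .seq (.assign 3 (.const 0)) (.seq (.assign 4 (.const 0)) (.seq (flipWords c)
    (.ite (.lt (.reg 4) (.reg 3)) (pushWords (continuations k c)) (flipWords c))))

/-- Try several flips. -/
def tryFlips (k : ℕ) : List (List (List ℕ)) → Prog
  | [] => .skip
  | c :: cs => .seq (tryFlip k c) (tryFlips k cs)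

/-- The sets of at most `k` vertices, given by words of length at most `k`. -/
def codes (k : ℕ) : List (List (List ℕ)) := listsUpTo (words k) k

/-- Pop a vertex and try all flips of at most `k` vertices near it. -/
def searchStep (k : ℕ) : Prog :=
  .seq (.assign 1 (.sub (.reg 1) (.const 1)))
    (.seq (.assign 2 (.read 3 (.reg 1))) (tryFlips k (codes k)))

/-- Push the least vertex that has not been pushed yet. -/
def pushNext : Prog := .seq (.write 3 (.reg 1) (.reg 1)) (.assign 1 (.succ (.reg 1)))

/-- Local search with a stack: array `2` holds the cut, array `3` the stack, register `1` its
height. -/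
def localSearch (k : ℕ) : Prog :=
  .seq (.loop (.lt (.reg 1) (.reg 0)) pushNext) (.loop (.lt (.const 0) (.reg 1)) (searchStep k))

theorem loopFree_flipVertex (e : Exp) : (flipVertex e).LoopFree := by
  simp [flipVertex, countPort, Prog.LoopFree]

theorem loopFree_flipWords (c : List (List ℕ)) : (flipWords c).LoopFree := by
  induction c with
  | nil => trivial
  | cons w c ih => exact ⟨loopFree_flipVertex _, ih⟩

theorem loopFree_pushWords (c : List (List ℕ)) : (pushWords c).LoopFree := by
  induction c with
  | nil => trivial
  | cons w c ih => exact ⟨trivial, trivial, ih⟩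

theorem loopFree_tryFlips (k : ℕ) (cs : List (List (List ℕ))) : (tryFlips k cs).LoopFree := by
  induction cs with
  | nil => trivial
  | cons c cs ih =>
    exact ⟨⟨trivial, trivial, loopFree_flipWords c, loopFree_pushWords _, loopFree_flipWords c⟩, ih⟩

theorem loopFree_searchStep (k : ℕ) : (searchStep k).LoopFree :=
  ⟨trivial, trivial, loopFree_tryFlips k _⟩

/-! ### The input -/

section Input

variable {n : ℕ} (adj : Fin n → List (Fin n))

theorem inputState_offset_succ (v : Fin n) : (inputState adj).arr 0 (v + 1) =
    (inputState adj).arr 0 v + (adj v).length := by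
  have h1 : v.val ≤ n := v.2.le
  have h2 : v.val + 1 ≤ n := v.2
  simp only [inputState, if_true, if_pos h1, if_pos h2]
  have h3 : (Finset.univ.filter fun u : Fin n => u.val < v.val + 1) =
      insert v (Finset.univ.filter fun u : Fin n => u.val < v.val) := by
    ext u
    simp only [Finset.mem_filter, Finset.mem_univ, true_and, Finset.mem_insert, Fin.ext_iff]
    omega
  rw [h3, Finset.sum_insert (by simp), add_comm]

theorem getElem?_flatten {α : Type*} (L : List (List α)) (i j : ℕ) (l : List α)
    (hi : L[i]? = some l) (hj : j < l.length) :
    L.flatten[((L.take i).map List.length).sum + j]? = l[j]? := by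
  induction L generalizing i with
  | nil => simp at hi
  | cons m L ih =>
    cases i with
    | zero =>
      simp only [List.getElem?_cons_zero, Option.some.injEq] at hi
      subst hi
      simp [List.getElem?_append_left hj]
    | succ i =>
      simp only [List.getElem?_cons_succ] at hi
      rw [← ih i hi, List.take_succ_cons, List.map_cons, List.sum_cons, List.flatten_cons, add_assoc,
        List.getElem?_append_right (Nat.le_add_right _ _), Nat.add_sub_cancel_left]

theorem inputState_offset (i : ℕ) (hi : i ≤ n) : (inputState adj).arr 0 i =
    (((List.ofFn adj).take i).map List.length).sum := by
  induction i with
  | zero => simp [inputState]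
  | succ i ih =>
    have h := inputState_offset_succ adj ⟨i, hi⟩
    simp only at h
    rw [h, ih (by omega), List.take_add_one, List.map_append, List.sum_append]
    simp [show i < n from hi]

theorem inputState_neighbour (v : Fin n) (j : ℕ) (hj : j < (adj v).length) :
    (inputState adj).arr 1 ((inputState adj).arr 0 v + j) = ((adj v)[j]).val := by
  rw [inputState_offset adj v v.2.le]
  have h := getElem?_flatten (List.ofFn adj) v j (adj v) (by simp) hj
  simp only [inputState, List.getD_eq_getElem?_getD, List.getElem?_map, one_ne_zero, if_false,
    if_true, h, List.getElem?_eq_getElem hj, Option.map_some, Option.getD_some]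

theorem inputState_lt (v : Fin n) (i : ℕ) : (inputState adj).arr 1 i < n := by
  simp only [inputState, List.getD_eq_getElem?_getD, List.getElem?_map, one_ne_zero, if_false,
    if_true]
  cases (List.ofFn adj).flatten[i]? with
  -- Past the end of the lists the array reads 0, which is a vertex because `v` exists. So words
  -- with missing ports still lead to vertices.
  | none => exact v.pos
  | some u => exact u.2

/-- The vertex in the place `j` of the list of `v`, or an arbitrary vertex if there is none. -/
def port (j : ℕ) (v : Fin n) : Fin n :=
  ⟨(inputState adj).arr 1 ((inputState adj).arr 0 v + j), inputState_lt adj v _⟩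

/-- The vertex that is reached from `v` along a word. -/
def node : Fin n → List ℕ → Fin n
  | v, [] => v
  | v, j :: w => node (port adj j v) w

theorem node_append (v : Fin n) (w w' : List ℕ) :
    node adj v (w ++ w') = node adj (node adj v w) w' := by
  induction w generalizing v with
  | nil => rfl
  | cons j w ih => exact ih _

theorem port_eq (v : Fin n) (j : ℕ) (hj : j < (adj v).length) : port adj j v = (adj v)[j] :=
  Fin.ext (inputState_neighbour adj v j hj)

theorem exists_word {G : SimpleGraph (Fin n)} {adj : Fin n → List (Fin n)}
    (hadj : IsAdjacencyList G adj) (hlen : ∀ v, (adj v).length ≤ 3) {v u : Fin n} (p : G.Walk v u)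
    {k : ℕ} (hp : p.length ≤ k) : ∃ w ∈ words k, node adj v w = u := by
  induction p generalizing k with
  | nil => exact ⟨[], by simp [words, mem_listsUpTo], rfl⟩
  | @cons v x u h p ih =>
    rw [SimpleGraph.Walk.length_cons] at hp
    obtain ⟨w, hw, e⟩ := ih (k := k - 1) (by omega)
    obtain ⟨j, hj, hx⟩ := List.mem_iff_getElem.1 (((hadj v).2 x).2 h)
    have := hlen v
    refine ⟨j :: w, ?_, ?_⟩
    · simp only [words, mem_listsUpTo, List.length_cons, List.mem_cons] at hw ⊢
      refine ⟨by omega, ?_⟩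
      rintro y (rfl | hy)
      · simp only [List.not_mem_nil, or_false]
        omega
      · exact hw.2 y hy
    · rw [node, port_eq adj v j hj, hx, e]

end Input

/-! ### The effect of the program -/

section Semantics

variable {n : ℕ} {G : SimpleGraph (Fin n)} {adj : Fin n → List (Fin n)}

/-- The state `s` holds the input `adj` and the cut `A`. -/
structure Holds (adj : Fin n → List (Fin n)) (A : Finset (Fin n)) (s : State) : Prop where
  offset : s.arr 0 = (inputState adj).arr 0
  neighbour : s.arr 1 = (inputState adj).arr 1
  side : ∀ v : Fin n, s.arr 2 v = if v ∈ A then 1 else 0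

theorem Holds.congr {A : Finset (Fin n)} {s s' : State} (h : Holds adj A s)
    (h0 : s'.arr 0 = s.arr 0) (h1 : s'.arr 1 = s.arr 1) (h2 : s'.arr 2 = s.arr 2) :
    Holds adj A s' :=
  ⟨h0.trans h.offset, h1.trans h.neighbour, fun v => by rw [h2, h.side]⟩

theorem eval_shift (s : State) (e : Exp) (j : ℕ) : (shift e j).eval s = e.eval s + j := by
  induction j with
  | zero => rfl
  | succ j ih => rw [shift, Exp.eval, ih]; rfl

theorem Holds.eval_portExp {A : Finset (Fin n)} {s : State} (h : Holds adj A s) {e : Exp}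
    {v : Fin n} (he : e.eval s = v) (j : ℕ) : (portExp j e).eval s = port adj j v := by
  simp [portExp, Exp.eval, eval_shift, h.offset, h.neighbour, he, port]

theorem Holds.eval_wordExp {A : Finset (Fin n)} {s : State} (h : Holds adj A s) (w : List ℕ)
    {e : Exp} {v : Fin n} (he : e.eval s = v) : (wordExp w e).eval s = node adj v w := by
  induction w generalizing e v with
  | nil => exact he
  | cons j w ih => exact ih (h.eval_portExp he j)

/-- What the neighbour in place `j` contributes to the gain of flipping `u`. -/
def portSign (adj : Fin n → List (Fin n)) (A : Finset (Fin n)) (u : Fin n) (j : ℕ) : ℤ :=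
  ((adj u)[j]?).elim 0 fun v => if (u ∈ A ↔ v ∈ A) then 1 else -1

theorem Holds.run_countPort {A : Finset (Fin n)} {s : State} (h : Holds adj A s) {u : Fin n}
    (hu : s.reg 5 = u) (j : ℕ) :
    ((countPort j).run s).arr = s.arr ∧
    (∀ x, x ≠ 3 → x ≠ 4 → ((countPort j).run s).reg x = s.reg x) ∧
    ((((countPort j).run s).reg 3 : ℤ) - ((countPort j).run s).reg 4 =
      s.reg 3 - s.reg 4 + portSign adj A u j) := by
  have h1 : Test.Holds s (.lt (shift (.read 0 (.reg 5)) j) (.read 0 (.succ (.reg 5)))) ↔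
      j < (adj u).length := by
    simp [Test.Holds, eval_shift, Exp.eval, h.offset, hu, inputState_offset_succ]
  have h2 : Test.Holds s (.eq (.read 2 (.reg 5)) (.read 2 (portExp j (.reg 5)))) ↔
      (u ∈ A ↔ port adj j u ∈ A) := by
    simp only [Test.Holds, Exp.eval, hu, h.eval_portExp (e := .reg 5) hu, h.side]
    by_cases h3 : u ∈ A <;> by_cases h4 : port adj j u ∈ A <;> simp [h3, h4]
  unfold countPort portSign
  simp only [Prog.run, h1, h2]
  by_cases hj : j < (adj u).length
  · rw [if_pos hj, List.getElem?_eq_getElem hj, Option.elim_some, ← port_eq adj u j hj]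
    split_ifs
    · refine ⟨rfl, fun x h3 h4 => by simp [State.setReg, h3], ?_⟩
      simp [State.setReg, Exp.eval]
      ring
    · refine ⟨rfl, fun x h3 h4 => by simp [State.setReg, h4], ?_⟩
      simp [State.setReg, Exp.eval]
      ring
  · rw [if_neg hj, List.getElem?_eq_none (not_lt.1 hj), Option.elim_none]
    exact ⟨rfl, fun _ _ _ => rfl, (add_zero _).symm⟩

theorem sum_portSign (hadj : IsAdjacencyList G adj) (hlen : ∀ v, (adj v).length ≤ 3)
    (A : Finset (Fin n)) (u : Fin n) :
    portSign adj A u 0 + portSign adj A u 1 + portSign adj A u 2 =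
      ∑ v ∈ {u}ᶜ, flipSign G A u v := by
  set F : Fin n → ℤ := fun v => if (u ∈ A ↔ v ∈ A) then 1 else -1 with hF
  have h1 : portSign adj A u 0 + portSign adj A u 1 + portSign adj A u 2 =
      ((adj u).map F).sum := by
    have := hlen u
    unfold portSign
    rw [← hF]
    generalize adj u = l at this
    match l, this with
    | [], _ => simp
    | [x], _ => simp
    | [x, y], _ => simp
    | [x, y, z], _ => simp [add_assoc]
    | _ :: _ :: _ :: _ :: l, h =>
      simp only [List.length_cons] at h
      omega
  rw [h1, ← List.sum_toFinset F (hadj u).1]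
  have hsub : (adj u).toFinset ⊆ {u}ᶜ := fun v hv => by
    rw [List.mem_toFinset, (hadj u).2] at hv
    simpa using hv.ne.symm
  rw [← Finset.sum_subset hsub]
  · refine Finset.sum_congr rfl fun v hv => ?_
    rw [List.mem_toFinset, (hadj u).2] at hv
    rw [flipSign, ind_of_adj hv, one_mul]
  · intro v _ hv
    rw [List.mem_toFinset, (hadj u).2] at hv
    rw [flipSign, ind_of_not_adj hv, zero_mul]

/-- The states `s` and `s'` have the same stack, and the same vertex in register `2`. -/
def SameStack (s s' : State) : Prop :=
  s'.arr 3 = s.arr 3 ∧ s'.reg 1 = s.reg 1 ∧ s'.reg 2 = s.reg 2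

theorem SameStack.trans {s s' s'' : State} (h : SameStack s s') (h' : SameStack s' s'') :
    SameStack s s'' :=
  ⟨h'.1.trans h.1, h'.2.1.trans h.2.1, h'.2.2.trans h.2.2⟩

theorem Holds.run_flipVertex (hadj : IsAdjacencyList G adj) (hlen : ∀ v, (adj v).length ≤ 3)
    {A : Finset (Fin n)} {s : State} (h : Holds adj A s) {e : Exp} {u : Fin n}
    (he : e.eval s = u) :
    Holds adj (symmDiff A {u}) ((flipVertex e).run s) ∧ SameStack s ((flipVertex e).run s) ∧
    (((flipVertex e).run s).reg 3 : ℤ) - ((flipVertex e).run s).reg 4 =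
      s.reg 3 - s.reg 4 + cutSize G (symmDiff A {u}) - cutSize G A := by
  simp only [flipVertex, Prog.run]
  set s0 := s.setReg 5 (e.eval s) with hs0
  have h0 : Holds adj A s0 := h.congr rfl rfl rfl
  have hu0 : s0.reg 5 = u := by simp [hs0, State.setReg, he]
  obtain ⟨a1, r1, g1⟩ := h0.run_countPort hu0 0
  set s1 := (countPort 0).run s0
  have h1 : Holds adj A s1 := h0.congr (by rw [a1]) (by rw [a1]) (by rw [a1])
  have hu1 : s1.reg 5 = u := by rw [r1 5 (by norm_num) (by norm_num), hu0]
  obtain ⟨a2, r2, g2⟩ := h1.run_countPort hu1 1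
  set s2 := (countPort 1).run s1
  have h2 : Holds adj A s2 := h1.congr (by rw [a2]) (by rw [a2]) (by rw [a2])
  have hu2 : s2.reg 5 = u := by rw [r2 5 (by norm_num) (by norm_num), hu1]
  obtain ⟨a3, r3, g3⟩ := h2.run_countPort hu2 2
  set s3 := (countPort 2).run s2
  have h3 : Holds adj A s3 := h2.congr (by rw [a3]) (by rw [a3]) (by rw [a3])
  have hu3 : s3.reg 5 = u := by rw [r3 5 (by norm_num) (by norm_num), hu2]
  have hr : ∀ x, x ≠ 3 → x ≠ 4 → x ≠ 5 → s3.reg x = s.reg x := fun x x3 x4 x5 => by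
    rw [r3 x x3 x4, r2 x x3 x4, r1 x x3 x4, hs0]
    simp [State.setReg, x5]
  refine ⟨⟨?_, ?_, fun v => ?_⟩, ⟨?_, ?_, ?_⟩, ?_⟩
  · simp [State.setArr, h3.offset]
  · simp [State.setArr, h3.neighbour]
  · simp only [State.setArr, Exp.eval, hu3, Function.update_self, h3.side, Finset.mem_symmDiff,
      Finset.mem_singleton]
    by_cases hvu : v = u
    · subst hvu
      by_cases hv : v ∈ A <;> simp [hv]
    · have : v.val ≠ u.val := fun h' => hvu (Fin.ext h')
      simp [Function.update_of_ne this, h3.side, hvu]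
  · simp [State.setArr, a3, a2, a1, hs0, State.setReg]
  · exact hr 1 (by norm_num) (by norm_num) (by norm_num)
  · exact hr 2 (by norm_num) (by norm_num) (by norm_num)
  · have g0 : s0.reg 3 = s.reg 3 ∧ s0.reg 4 = s.reg 4 := by simp [hs0, State.setReg]
    have hc := cutSize_symmDiff G A {u}
    rw [Finset.sum_singleton, ← sum_portSign hadj hlen] at hc
    simp only [State.setArr]
    rw [g0.1, g0.2] at g1
    linarith

/-- The set of the vertices that are reached from `v` along an odd number of the words in `c`. -/
def toggled (adj : Fin n → List (Fin n)) (v : Fin n) : List (List ℕ) → Finset (Fin n)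
  | [] => ∅
  | w :: c => symmDiff {node adj v w} (toggled adj v c)

/-- The changes by single flips telescope, each being measured against the current cut. Hence the
counters are correct even if several words lead to the same vertex. -/
theorem Holds.run_flipWords (hadj : IsAdjacencyList G adj) (hlen : ∀ v, (adj v).length ≤ 3)
    {A : Finset (Fin n)} {s : State} (h : Holds adj A s) {v : Fin n} (hv : s.reg 2 = v)
    (c : List (List ℕ)) :
    Holds adj (symmDiff A (toggled adj v c)) ((flipWords c).run s) ∧
    SameStack s ((flipWords c).run s) ∧
    (((flipWords c).run s).reg 3 : ℤ) - ((flipWords c).run s).reg 4 =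
      s.reg 3 - s.reg 4 + cutSize G (symmDiff A (toggled adj v c)) - cutSize G A := by
  induction c generalizing A s with
  | nil =>
    have e : symmDiff A (toggled adj v []) = A := by simp [toggled]
    rw [e]
    exact ⟨h, ⟨rfl, rfl, rfl⟩, by simp [flipWords, Prog.run]⟩
  | cons w c ih =>
    obtain ⟨h1, h2, h3⟩ := h.run_flipVertex hadj hlen (h.eval_wordExp w (e := .reg 2) hv)
    obtain ⟨h4, h5, h6⟩ := ih h1 (h2.2.2.trans hv)
    have e : symmDiff A (toggled adj v (w :: c)) =
        symmDiff (symmDiff A {node adj v w}) (toggled adj v c) := (symmDiff_assoc _ _ _).symm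
    rw [e]
    refine ⟨h4, h2.trans h5, ?_⟩
    simp only [flipWords, Prog.run]
    linarith

/-- The vertex `x` is on the stack. -/
def OnStack (s : State) (x : Fin n) : Prop := ∃ i < s.reg 1, s.arr 3 i = x

theorem Holds.run_pushWords {A : Finset (Fin n)} {s : State} (h : Holds adj A s) {v : Fin n}
    (hv : s.reg 2 = v) (hs : ∀ i < s.reg 1, s.arr 3 i < n) (c : List (List ℕ)) :
    Holds adj A ((pushWords c).run s) ∧ ((pushWords c).run s).reg 2 = v ∧
    ((pushWords c).run s).reg 1 = s.reg 1 + c.length ∧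
    (∀ i < ((pushWords c).run s).reg 1, ((pushWords c).run s).arr 3 i < n) ∧
    (∀ x : Fin n, OnStack s x → OnStack ((pushWords c).run s) x) ∧
    ∀ w ∈ c, OnStack ((pushWords c).run s) (node adj v w) := by
  induction c generalizing s with
  | nil => exact ⟨h, hv, rfl, hs, fun _ hx => hx, by simp⟩
  | cons w c ih =>
    simp only [pushWords, Prog.run]
    have he := h.eval_wordExp w (e := .reg 2) hv
    set s' := (s.setArr 3 (Exp.eval s (.reg 1)) ((wordExp w (.reg 2)).eval s)).setReg 1
      ((Exp.succ (.reg 1)).eval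
        (s.setArr 3 (Exp.eval s (.reg 1)) ((wordExp w (.reg 2)).eval s))) with hs'
    have e1 : s'.reg 1 = s.reg 1 + 1 := by simp [hs', State.setReg, State.setArr, Exp.eval]
    have e2 : s'.reg 2 = s.reg 2 := by simp [hs', State.setReg, State.setArr]
    have e3 : ∀ i, s'.arr 3 i = if i = s.reg 1 then (node adj v w).val else s.arr 3 i := fun i => by
      simp [hs', State.setReg, State.setArr, he, Function.update_apply, Exp.eval]
    have h' : Holds adj A s' := h.congr (by simp [hs', State.setReg, State.setArr])
      (by simp [hs', State.setReg, State.setArr]) (by simp [hs', State.setReg, State.setArr])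
    obtain ⟨i1, i2, i3, i4, i5, i6⟩ := ih h' (e2.trans hv) fun i hi => by
      rw [e3]
      split_ifs with hi'
      · exact Fin.is_lt _
      · exact hs i (by omega)
    refine ⟨i1, i2, by rw [i3, e1, List.length_cons]; omega, i4, ?_, ?_⟩
    · rintro x ⟨i, hi, hx⟩
      exact i5 x ⟨i, by omega, by rw [e3, if_neg (by omega), hx]⟩
    · rintro w' hw'
      rcases List.mem_cons.1 hw' with rfl | hw'
      · exact i5 _ ⟨s.reg 1, by omega, by rw [e3, if_pos rfl]⟩
      · exact i6 w' hw'

end Semantics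

/-! ### Distances, and the locality of improving flips -/

/-- The vertices `v` and `u` have distance at most `k`. -/
def Near {V : Type*} (G : SimpleGraph V) (k : ℕ) (v u : V) : Prop :=
  ∃ p : G.Walk v u, p.length ≤ k

theorem Near.symm {V : Type*} {G : SimpleGraph V} {k : ℕ} {v u : V} (h : Near G k v u) :
    Near G k u v := by
  obtain ⟨p, hp⟩ := h
  exact ⟨p.reverse, by simpa using hp⟩

theorem Near.mono {V : Type*} {G : SimpleGraph V} {k l : ℕ} (hkl : k ≤ l) {v u : V}
    (h : Near G k v u) : Near G l v u := by
  obtain ⟨p, hp⟩ := h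
  exact ⟨p, hp.trans hkl⟩

theorem Near.step {V : Type*} {G : SimpleGraph V} {k : ℕ} {v u x : V} (h : Near G k v u)
    (hux : G.Adj u x) : Near G (k + 1) v x := by
  obtain ⟨p, hp⟩ := h
  exact ⟨p.concat hux, by simpa using hp⟩

/-- The ball of radius `j` within `T` gains a vertex with every step until it is all of `T`. -/
theorem Linked.near {V : Type*} [DecidableEq V] {G : SimpleGraph V} {T : Finset V}
    (hT : Linked G T) {v : V} (hv : v ∈ T) {u : V} (hu : u ∈ T) : Near G T.card v u := by
  classical
  have h : ∀ j, T ⊆ T.filter (Near G j v) ∨ j + 1 ≤ (T.filter (Near G j v)).card := fun j => by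
    induction j with
    | zero => exact Or.inr (Finset.card_pos.2 ⟨v, by simpa [hv] using ⟨.nil, le_rfl⟩⟩)
    | succ j ih =>
      have hsub : T.filter (Near G j v) ⊆ T.filter (Near G (j + 1) v) := fun x hx => by
        rw [Finset.mem_filter] at hx ⊢
        exact ⟨hx.1, hx.2.mono (Nat.le_succ j)⟩
      rcases ih with ih | ih
      · exact Or.inl (ih.trans hsub)
      by_cases hs : T ⊆ T.filter (Near G j v)
      · exact Or.inl (hs.trans hsub)
      obtain ⟨x, hx, hx'⟩ := Finset.not_subset.1 hs
      obtain ⟨y, -, z, hz, hyT, hzT, hyz⟩ := hT.exists_adj_compl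
        (T := T.filter (Near G j v)) hv
        (Finset.mem_filter.2 ⟨hv, .nil, Nat.zero_le j⟩) hx hx'
      right
      have hz' : z ∈ T.filter (Near G (j + 1) v) :=
        Finset.mem_filter.2 ⟨hz, (Finset.mem_filter.1 hyT).2.step hyz⟩
      have h1 := Finset.card_le_card (Finset.insert_subset hz' hsub)
      rw [Finset.card_insert_of_notMem hzT] at h1
      omega
  rcases h T.card with h | h
  · exact (Finset.mem_filter.1 (h hu)).2
  · have := Finset.card_filter_le T (Near G T.card v)
    omega

section Stable

variable {n : ℕ} {G : SimpleGraph (Fin n)} {adj : Fin n → List (Fin n)}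

/-- No flip of at most `k` vertices at distance at most `k` from `v` improves the cut `A`. -/
def Stable (G : SimpleGraph (Fin n)) (k : ℕ) (A : Finset (Fin n)) (v : Fin n) : Prop :=
  ∀ T : Finset (Fin n), T.card ≤ k → (∀ u ∈ T, Near G k v u) →
    cutSize G (symmDiff A T) ≤ cutSize G A

/-- The effect of flipping `T` depends only on the sides of `T` and its neighbours, all within
distance `k + 1` of `v`. -/
theorem Stable.symmDiff {k : ℕ} {A D : Finset (Fin n)} {v : Fin n} (h : Stable G k A v)
    (hD : ∀ d ∈ D, ¬ Near G (k + 1) v d) : Stable G k (symmDiff A D) v := by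
  intro T hc hT
  have h1 := h T hc hT
  have h2 := cutSize_symmDiff G A T
  have h3 := cutSize_symmDiff G (_root_.symmDiff A D) T
  have hmem : ∀ x, Near G (k + 1) v x → (x ∈ _root_.symmDiff A D ↔ x ∈ A) := fun x hx => by
    have : x ∉ D := fun h' => hD x h' hx
    simp [Finset.mem_symmDiff, this]
  have h4 : ∑ u ∈ T, ∑ w ∈ Tᶜ, flipSign G (_root_.symmDiff A D) u w =
      ∑ u ∈ T, ∑ w ∈ Tᶜ, flipSign G A u w := by
    refine Finset.sum_congr rfl fun u hu => Finset.sum_congr rfl fun w _ => ?_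
    by_cases huw : G.Adj u w
    · simp only [flipSign, hmem u ((hT u hu).mono (Nat.le_succ k)), hmem w ((hT u hu).step huw)]
    · rw [flipSign, flipSign, ind_of_not_adj huw, zero_mul, zero_mul]
  have h5 : (cutSize G (_root_.symmDiff A T) : ℤ) ≤ cutSize G A := by exact_mod_cast h1
  have h6 : (cutSize G (_root_.symmDiff (_root_.symmDiff A D) T) : ℤ) ≤
      cutSize G (_root_.symmDiff A D) := by linarith
  exact_mod_cast h6

theorem exists_mem_of_mem_toggled {v d : Fin n} {c : List (List ℕ)} (h : d ∈ toggled adj v c) :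
    ∃ w ∈ c, node adj v w = d := by
  induction c with
  | nil => simp [toggled] at h
  | cons w c ih =>
    rw [toggled, Finset.mem_symmDiff, Finset.mem_singleton] at h
    rcases h with ⟨h, -⟩ | ⟨h, -⟩
    · exact ⟨w, by simp, h.symm⟩
    · obtain ⟨w', hw', e⟩ := ih h
      exact ⟨w', by simp [hw'], e⟩

theorem exists_code (hadj : IsAdjacencyList G adj) (hlen : ∀ v, (adj v).length ≤ 3) {k : ℕ}
    {v : Fin n} {T : Finset (Fin n)} (hc : T.card ≤ k) (hT : ∀ u ∈ T, Near G k v u) :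
    ∃ c ∈ codes k, toggled adj v c = T := by
  have hw : ∀ u, ∃ w, u ∈ T → w ∈ words k ∧ node adj v w = u := fun u => by
    by_cases hu : u ∈ T
    · obtain ⟨p, hp⟩ := hT u hu
      obtain ⟨w, h⟩ := exists_word hadj hlen p hp
      exact ⟨w, fun _ => h⟩
    · exact ⟨[], fun h => absurd h hu⟩
  choose w hw using hw
  have key : ∀ l : List (Fin n), l.Nodup → (∀ u ∈ l, u ∈ T) →
      toggled adj v (l.map w) = l.toFinset := fun l => by
    induction l with
    | nil => simp [toggled]
    | cons u l ih =>
      intro hl hlT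
      rw [List.nodup_cons] at hl
      rw [List.map_cons, toggled, ih hl.2 fun x hx => hlT x (by simp [hx]),
        (hw u (hlT u (by simp))).2, List.toFinset_cons]
      ext x
      simp only [Finset.mem_symmDiff, Finset.mem_singleton, List.mem_toFinset, Finset.mem_insert]
      by_cases hx : x = u
      · subst hx
        simp [hl.1]
      · simp [hx]
  refine ⟨T.toList.map w, ?_, ?_⟩
  · simp only [codes, mem_listsUpTo, List.length_map, Finset.length_toList, List.mem_map]
    refine ⟨hc, ?_⟩
    rintro x ⟨u, hu, rfl⟩
    exact (hw u (Finset.mem_toList.1 hu)).1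
  · rw [key _ T.nodup_toList fun u hu => Finset.mem_toList.1 hu, Finset.toList_toFinset]

/-- The state of the search while the flips around `v` are tried: those in `done` do not improve
the cut, or `v` is on the stack again. -/
structure Searching (G : SimpleGraph (Fin n)) (adj : Fin n → List (Fin n)) (k : ℕ) (v : Fin n)
    (done : List (List ℕ) → Prop) (A : Finset (Fin n)) (s : State) : Prop where
  holds : Holds adj A s
  current : s.reg 2 = v
  stack_lt : ∀ i < s.reg 1, s.arr 3 i < n
  stable : ∀ w, w ≠ v → OnStack s w ∨ Stable G k A w
  tried : OnStack s v ∨ ∀ c, done c → cutSize G (symmDiff A (toggled adj v c)) ≤ cutSize G A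

theorem length_continuations_le {k : ℕ} {c : List (List ℕ)} (hc : c.length ≤ k) :
    (continuations k c).length ≤ k * (words (k + 1)).length + 1 := by
  rw [continuations, List.length_cons, List.length_flatMap]
  simp only [List.length_map, List.map_const', List.sum_replicate, smul_eq_mul]
  exact Nat.succ_le_succ (Nat.mul_le_mul_right _ hc)

/-- The height of the stack, and the pushes that improvements of the cut can still cause. -/
noncomputable def potential (G : SimpleGraph (Fin n)) (k : ℕ) (A : Finset (Fin n)) (s : State) :
    ℕ :=
  s.reg 1 + (k * (words (k + 1)).length + 1) * (maxCut G - cutSize G A)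

theorem cutSize_le_maxCut (G : SimpleGraph (Fin n)) (A : Finset (Fin n)) :
    cutSize G A ≤ maxCut G :=
  Finset.le_sup (f := cutSize G) (Finset.mem_univ A)

/-- After an improvement, stability can fail only within distance `k + 1` of a flipped vertex, and
all these vertices are pushed; the larger cut pays for the pushes in the potential. Otherwise the
second flip restores the cut. -/
theorem Searching.run_tryFlip (hadj : IsAdjacencyList G adj) (hlen : ∀ v, (adj v).length ≤ 3)
    {k : ℕ} {v : Fin n} {done : List (List ℕ) → Prop} {A : Finset (Fin n)} {s : State}
    (h : Searching G adj k v done A s) {c : List (List ℕ)} (hc : c ∈ codes k) :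
    ∃ A', Searching G adj k v (fun c' => c' = c ∨ done c') A' ((tryFlip k c).run s) ∧
      potential G k A' ((tryFlip k c).run s) ≤ potential G k A s := by
  set s0 := (s.setReg 3 ((Exp.const 0).eval s)).setReg 4
    ((Exp.const 0).eval (s.setReg 3 ((Exp.const 0).eval s))) with hs0
  have e3 : s0.reg 3 = 0 := by simp [hs0, State.setReg, Exp.eval]
  have e4 : s0.reg 4 = 0 := by simp [hs0, State.setReg, Exp.eval]
  have e0 : SameStack s s0 := by
    refine ⟨?_, ?_, ?_⟩ <;> simp [hs0, State.setReg]
  have h0 : Holds adj A s0 := h.holds.congr rfl rfl rfl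
  obtain ⟨h1, t1, g1⟩ := h0.run_flipWords hadj hlen (e0.2.2.trans h.current) c
  set s1 := (flipWords c).run s0
  have hrun : (tryFlip k c).run s = (Prog.ite (.lt (.reg 4) (.reg 3))
    (pushWords (continuations k c)) (flipWords c)).run s1 := rfl
  replace t1 := e0.trans t1
  set D := toggled adj v c with hD
  have hv1 : s1.reg 2 = v := t1.2.2.trans h.current
  have honStack : ∀ {s' : State}, SameStack s s' → ∀ x : Fin n, OnStack s' x ↔ OnStack s x :=
    fun ht x => by
      unfold OnStack
      rw [ht.1, ht.2.1]
  by_cases hlt : Test.Holds s1 (.lt (.reg 4) (.reg 3))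
  · rw [hrun, Prog.run_ite_of_holds hlt]
    have hcut : cutSize G A < cutSize G (symmDiff A D) := by
      simp only [Test.Holds, Exp.eval] at hlt
      rw [e3, e4] at g1
      omega
    obtain ⟨h2, hv2, hr2, hl2, hs2, hp2⟩ := h1.run_pushWords hv1
      (by rw [t1.1, t1.2.1]; exact h.stack_lt) (continuations k c)
    have hpush : ∀ x d, d ∈ D → Near G (k + 1) x d →
        OnStack ((pushWords (continuations k c)).run s1) x := fun x d hd hx => by
      obtain ⟨w, hw, rfl⟩ := exists_mem_of_mem_toggled hd
      obtain ⟨p, hp⟩ := hx.symm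
      obtain ⟨w', hw', rfl⟩ := exists_word hadj hlen p hp
      rw [← node_append]
      exact hp2 _ (List.mem_cons_of_mem _
        (List.mem_flatMap.2 ⟨w, hw, List.mem_map.2 ⟨w', hw', rfl⟩⟩))
    have hstable : ∀ x, OnStack s x ∨ Stable G k A x →
        OnStack ((pushWords (continuations k c)).run s1) x ∨ Stable G k (symmDiff A D) x :=
      fun x hx => by
        rcases hx with hx | hx
        · exact Or.inl (hs2 x ((honStack t1 x).2 hx))
        by_cases hd : ∃ d ∈ D, Near G (k + 1) x d
        · obtain ⟨d, hd, hxd⟩ := hd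
          exact Or.inl (hpush x d hd hxd)
        · exact Or.inr (hx.symmDiff fun d hd' hxd => hd ⟨d, hd', hxd⟩)
    refine ⟨symmDiff A D, ⟨h2, hv2, hl2, fun w hw => hstable w (h.stable w hw), ?_⟩, ?_⟩
    -- The empty word pushes `v` itself, so flips tried before the improvement need no second look.
    · exact Or.inl (hp2 [] List.mem_cons_self)
    · have h3 := cutSize_le_maxCut G (symmDiff A D)
      have h4 := length_continuations_le (k := k) (c := c) (by
        rw [codes, mem_listsUpTo] at hc
        exact hc.1)
      have h5 := Nat.mul_le_mul_left (k * (words (k + 1)).length + 1)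
        (show maxCut G - cutSize G (symmDiff A D) + 1 ≤ maxCut G - cutSize G A by omega)
      rw [Nat.mul_add, mul_one (_ + 1)] at h5
      unfold potential
      rw [hr2, t1.2.1]
      omega
  · rw [hrun, Prog.run_ite_of_not_holds hlt]
    have hcut : cutSize G (symmDiff A D) ≤ cutSize G A := by
      simp only [Test.Holds, Exp.eval] at hlt
      rw [e3, e4] at g1
      omega
    obtain ⟨h2, t2, -⟩ := h1.run_flipWords hadj hlen hv1 c
    replace t2 := t1.trans t2
    rw [← hD, symmDiff_symmDiff_cancel_right] at h2
    refine ⟨A, ⟨h2, t2.2.2.trans h.current, by rw [t2.1, t2.2.1]; exact h.stack_lt,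
      fun w hw => (h.stable w hw).imp_left (honStack t2 w).2, ?_⟩, ?_⟩
    · refine h.tried.imp (honStack t2 v).2 fun ht c' hc' => ?_
      rcases hc' with rfl | hc'
      · exact hcut
      · exact ht c' hc'
    · unfold potential
      rw [t2.2.1]

end Stable

/-! ### The search invariant and the linear time bound -/

section Correctness

variable {n : ℕ} {G : SimpleGraph (Fin n)} {adj : Fin n → List (Fin n)}

theorem Searching.run_tryFlips (hadj : IsAdjacencyList G adj) (hlen : ∀ v, (adj v).length ≤ 3)
    {k : ℕ} {v : Fin n} {done : List (List ℕ) → Prop} {A : Finset (Fin n)} {s : State}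
    (h : Searching G adj k v done A s) (cs : List (List (List ℕ))) (hcs : ∀ c ∈ cs, c ∈ codes k) :
    ∃ A', Searching G adj k v (fun c => c ∈ cs ∨ done c) A' ((tryFlips k cs).run s) ∧
      potential G k A' ((tryFlips k cs).run s) ≤ potential G k A s := by
  induction cs generalizing done A s with
  | nil => exact ⟨A, ⟨h.holds, h.current, h.stack_lt, h.stable,
      h.tried.imp_right fun ht c hc => ht c (hc.resolve_left List.not_mem_nil)⟩, le_rfl⟩
  | cons c cs ih =>
    obtain ⟨A₁, h1, p1⟩ := h.run_tryFlip hadj hlen (hcs c (by simp))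
    obtain ⟨A₂, h2, p2⟩ := ih h1 fun c' hc' => hcs c' (by simp [hc'])
    refine ⟨A₂, ⟨h2.holds, h2.current, h2.stack_lt, h2.stable, ?_⟩, p2.trans p1⟩
    refine h2.tried.imp_right fun ht c' hc' => ht c' ?_
    rw [List.mem_cons] at hc'
    tauto

theorem Holds.outputSet_eq {A : Finset (Fin n)} {s : State} (h : Holds adj A s) :
    outputSet n s = A := by
  ext v
  simp [outputSet, h.side]

/-- Every vertex is on the stack, or no flip near it improves the cut. -/
structure SearchInvariant (G : SimpleGraph (Fin n)) (adj : Fin n → List (Fin n)) (k : ℕ)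
    (s : State) : Prop where
  holds : Holds adj (outputSet n s) s
  stack_lt : ∀ i < s.reg 1, s.arr 3 i < n
  stable : ∀ w, OnStack s w ∨ Stable G k (outputSet n s) w

/-- Popping lowers the potential by 1 and the attempted flips never raise it. The popped `v` either
returns to the stack or has survived all codes, which cover every set in the definition of `Stable`.
-/
theorem SearchInvariant.run_searchStep (hadj : IsAdjacencyList G adj)
    (hlen : ∀ v, (adj v).length ≤ 3) {k : ℕ} {s : State} (h : SearchInvariant G adj k s)
    (hs : 0 < s.reg 1) :
    SearchInvariant G adj k ((searchStep k).run s) ∧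
      potential G k (outputSet n ((searchStep k).run s)) ((searchStep k).run s) <
        potential G k (outputSet n s) s := by
  set A := outputSet n s with hA
  have hlt := h.stack_lt (s.reg 1 - 1) (by omega)
  set v : Fin n := ⟨s.arr 3 (s.reg 1 - 1), hlt⟩ with hv
  set s1 := s.setReg 1 ((Exp.sub (.reg 1) (.const 1)).eval s) with hs1
  set s2 := s1.setReg 2 ((Exp.read 3 (.reg 1)).eval s1) with hs2
  have hrun : (searchStep k).run s = (tryFlips k (codes k)).run s2 := rfl
  have e1 : s2.reg 1 = s.reg 1 - 1 := by simp [hs2, hs1, State.setReg, Exp.eval]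
  have e2 : s2.reg 2 = v := by simp [hs2, hs1, State.setReg, Exp.eval, hv]
  have e3 : s2.arr = s.arr := rfl
  have h2 : Searching G adj k v (fun _ => False) A s2 := by
    refine ⟨h.holds.congr rfl rfl rfl, e2, fun i hi => ?_, fun w hw => ?_, Or.inr (by simp)⟩
    · rw [e1] at hi
      exact h.stack_lt i (by omega)
    · refine (h.stable w).imp_left ?_
      rintro ⟨i, hi, hiw⟩
      refine ⟨i, ?_, hiw⟩
      have : i ≠ s.reg 1 - 1 := by
        rintro rfl
        exact hw (Fin.ext hiw.symm)
      omega
  obtain ⟨A', h3, hp⟩ := h2.run_tryFlips hadj hlen (codes k) fun _ hc => hc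
  have hA' := h3.holds.outputSet_eq
  rw [hrun]
  refine ⟨⟨by rw [hA']; exact h3.holds, h3.stack_lt, fun w => ?_⟩, ?_⟩
  · rw [hA']
    by_cases hw : w = v
    · subst hw
      refine h3.tried.imp_right fun ht T hc hT => ?_
      obtain ⟨c, hck, rfl⟩ := exists_code hadj hlen hc hT
      exact ht c (Or.inl hck)
    · exact h3.stable w hw
  · rw [hA']
    refine hp.trans_lt ?_
    unfold potential
    rw [e1]
    omega

/-- The vertices below the height of the stack have been pushed, and the cut is empty. -/
structure PushInvariant (adj : Fin n → List (Fin n)) (s : State) : Prop where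
  size : s.reg 0 = n
  offset : s.arr 0 = (inputState adj).arr 0
  neighbour : s.arr 1 = (inputState adj).arr 1
  side : ∀ i, s.arr 2 i = 0
  height_le : s.reg 1 ≤ n
  stack : ∀ i < s.reg 1, s.arr 3 i = i

theorem PushInvariant.run_pushNext {s : State} (h : PushInvariant adj s)
    (hs : s.reg 1 < s.reg 0) :
    PushInvariant adj (pushNext.run s) ∧ n - (pushNext.run s).reg 1 < n - s.reg 1 := by
  have e1 : (pushNext.run s).reg 1 = s.reg 1 + 1 := by
    simp [pushNext, Prog.run, State.setReg, State.setArr, Exp.eval]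
  have e3 : ∀ i, (pushNext.run s).arr 3 i = if i = s.reg 1 then s.reg 1 else s.arr 3 i := fun i => by
    simp [pushNext, Prog.run, State.setReg, State.setArr, Exp.eval, Function.update_apply]
  have hn := h.size
  refine ⟨⟨?_, ?_, ?_, ?_, by omega, fun i hi => ?_⟩, by omega⟩
  · simpa [pushNext, Prog.run, State.setReg, State.setArr] using h.size
  · simpa [pushNext, Prog.run, State.setReg, State.setArr] using h.offset
  · simpa [pushNext, Prog.run, State.setReg, State.setArr] using h.neighbour
  · simpa [pushNext, Prog.run, State.setReg, State.setArr] using h.side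
  · rw [e3]
    split_ifs with hi'
    · exact hi'.symm
    · exact h.stack i (by omega)

theorem pushInvariant_inputState (adj : Fin n → List (Fin n)) :
    PushInvariant adj (inputState adj) :=
  ⟨rfl, rfl, rfl, fun _ => rfl, Nat.zero_le _, fun i hi => absurd hi (Nat.not_lt_zero i)⟩

theorem PushInvariant.searchInvariant {s : State} (h : PushInvariant adj s) (hs : s.reg 1 = n)
    (k : ℕ) : SearchInvariant G adj k s := by
  have h1 : Holds adj (∅ : Finset (Fin n)) s :=
    ⟨h.offset, h.neighbour, fun v => by simp [h.side]⟩
  refine ⟨by rw [h1.outputSet_eq]; exact h1, fun i hi => ?_, fun w => Or.inl ⟨w, ?_, ?_⟩⟩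
  · rw [h.stack i hi]
    omega
  · rw [hs]
    exact w.2
  · exact h.stack w (by rw [hs]; exact w.2)

theorem maxCut_le (hG : ∀ v, ideg G v ≤ 3) : maxCut G ≤ 3 * n := by
  obtain ⟨B, hB⟩ := exists_cutSize_eq_maxCut G
  have h1 := two_mul_cutSize G B
  have h2 : ∑ u, ∑ v, ind G u v * (if (u ∈ B ↔ v ∈ B) then 0 else 1) ≤ ∑ u : Fin n, 3 := by
    refine Finset.sum_le_sum fun u _ => le_trans (Finset.sum_le_sum fun v _ => ?_) (hG u)
    have := ind_nonneg G u v
    split_ifs <;> simp [this]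
  simp only [Finset.sum_const, Finset.card_univ, Fintype.card_fin, nsmul_eq_mul] at h2
  rw [hB]
  omega

theorem length_eq_degree [DecidableRel G.Adj] (hadj : IsAdjacencyList G adj) (v : Fin n) :
    (adj v).length = G.degree v := by
  rw [← List.toFinset_card_of_nodup (hadj v).1, ← SimpleGraph.card_neighborFinset_eq_degree]
  congr 1
  ext u
  simp [(hadj v).2]

theorem ideg_eq_degree [DecidableRel G.Adj] (v : Fin n) : ideg G v = G.degree v := by
  rw [ideg_eq_card, ← SimpleGraph.card_neighborFinset_eq_degree]
  congr 2
  ext u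
  simp

end Correctness

/-- Local search finds in linear time a cut of a subcubic graph that no flip of at most `k` vertices
near a vertex improves. -/
theorem exists_exec_localSearch (k : ℕ) :
    ∃ C : ℕ, ∀ (n : ℕ) (G : SimpleGraph (Fin n)) (adj : Fin n → List (Fin n)),
      IsAdjacencyList G adj → (∀ v, (adj v).length ≤ 3) → (∀ v, ideg G v ≤ 3) →
      ∃ (s : State) (t : ℕ), Exec (localSearch k) (inputState adj) s t ∧ t ≤ C * (n + 1) ∧
        ∀ v, Stable G k (outputSet n s) v := by
  let b₁ : Test := .lt (.reg 1) (.reg 0)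
  let b₂ : Test := .lt (.const 0) (.reg 1)
  let c₁ := b₁.cost + 1 + pushNext.maxCost
  let c₂ := b₂.cost + 1 + (searchStep k).maxCost
  let β := k * (words (k + 1)).length + 1
  -- At most `n` initial pushes, then at most `n + β * (3 * n)` pops.
  refine ⟨c₁ + (b₁.cost + 1) + ((1 + 3 * β) * c₂ + (b₂.cost + 1)), fun n G adj hadj hlen hG => ?_⟩
  obtain ⟨s₁, t₁, h₁, ht₁, hi₁, hb₁⟩ := exec_loop (b := b₁) (p := pushNext) ⟨trivial, trivial⟩
    (PushInvariant adj) (fun s => n - s.reg 1) (fun s hs hb => hs.run_pushNext hb)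
    (inputState adj) (pushInvariant_inputState adj)
  have hr : s₁.reg 1 = n := by
    have h1 := hi₁.size
    have h2 := hi₁.height_le
    have h3 : ¬ s₁.reg 1 < s₁.reg 0 := hb₁
    omega
  obtain ⟨s₂, t₂, h₂, ht₂, hi₂, hb₂⟩ := exec_loop (b := b₂) (loopFree_searchStep k)
    (SearchInvariant G adj k) (fun s => potential G k (outputSet n s) s)
    (fun s hs hb => hs.run_searchStep hadj hlen hb) s₁ (hi₁.searchInvariant hr k)
  refine ⟨s₂, t₁ + t₂, .seq h₁ h₂, ?_, fun v => (hi₂.stable v).resolve_left ?_⟩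
  · have h3 : potential G k (outputSet n s₁) s₁ ≤ n * (1 + 3 * β) := by
      have h4 : maxCut G - cutSize G (outputSet n s₁) ≤ 3 * n := (Nat.sub_le _ _).trans (maxCut_le hG)
      have h5 := Nat.mul_le_mul_left β h4
      unfold potential
      rw [hr]
      calc _ ≤ n + β * (3 * n) := Nat.add_le_add_left h5 n
        _ = _ := by ring
    have h6 : t₁ ≤ n * c₁ + (b₁.cost + 1) :=
      ht₁.trans (Nat.add_le_add_right (Nat.mul_le_mul_right _ (Nat.sub_le _ _)) _)
    have h7 : t₂ ≤ n * (1 + 3 * β) * c₂ + (b₂.cost + 1) :=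
      ht₂.trans (Nat.add_le_add_right (Nat.mul_le_mul_right _ h3) _)
    refine (add_le_add h6 h7).trans ?_
    generalize c₁ = x, b₁.cost + 1 = y, (1 + 3 * β) = z, c₂ = u, b₂.cost + 1 = w
    have : (x + y + (z * u + w)) * (n + 1) =
      n * x + y + (n * z * u + w) + (x + n * y + z * u + n * w) := by ring
    omega
  · rintro ⟨i, hi, -⟩
    exact hb₂ (show 0 < s₂.reg 1 by omega)

theorem five_mul_maxCut_le_of_stable {n : ℕ} {G : SimpleGraph (Fin n)} (hG : ∀ v, ideg G v ≤ 3)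
    {A : Finset (Fin n)} (hA : ∀ v, Stable G 520 A v) : 5 * maxCut G ≤ 6 * cutSize G A :=
  five_mul_maxCut_le hG fun T hT hc => by
    obtain ⟨v, hv⟩ := hT.1
    exact hA v T hc fun u hu => (hT.near hv hu).mono hc

end MaxCut

theorem corollary3 :
    ∃ (p : RAM.Prog) (C : ℕ), ∀ (n : ℕ) (G : SimpleGraph (Fin n)) [DecidableRel G.Adj],
      (∀ v, G.degree v ≤ 3) →
      ∀ adj : Fin n → List (Fin n), MaxCut.IsAdjacencyList G adj →
        ∃ (s : RAM.State) (t : ℕ),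
          RAM.Exec p (MaxCut.inputState adj) s t ∧
          t ≤ C * (n + 1) ∧
          (5 / 6 : ℚ) * (MaxCut.maxCut G : ℚ) ≤
            (MaxCut.cutSize G (MaxCut.outputSet n s) : ℚ) := by
  obtain ⟨C, hC⟩ := MaxCut.exists_exec_localSearch 520
  refine ⟨MaxCut.localSearch 520, C, fun n G _ hdeg adj hadj => ?_⟩
  have hG : ∀ v, MaxCut.ideg G v ≤ 3 := fun v => by
    rw [MaxCut.ideg_eq_degree]
    exact_mod_cast hdeg v
  obtain ⟨s, t, he, ht, hs⟩ := hC n G adj hadj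
    (fun v => (MaxCut.length_eq_degree hadj v).trans_le (hdeg v)) hG
  refine ⟨s, t, he, ht, ?_⟩
  have h : (5 * MaxCut.maxCut G : ℚ) ≤ 6 * MaxCut.cutSize G (MaxCut.outputSet n s) := by
    exact_mod_cast MaxCut.five_mul_maxCut_le_of_stable hG hs
  linarith
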